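/- **Setting.** Let $p$ be prime, let $\mathbb G_1,\mathbb G_2,\mathbb G_T$ be groups of order $p$ with generators $g,g_1,g_2\in\mathbb G_1$, $h\in\mathbb G_2$, and let $\hat e:\mathbb G_1\times\mathbb G_2\to\mathbb G_T$ be a bilinear map with $\hat e(g,h)\ne 1$. Let $H$ be an arbitrary function (the hash function) from the inputs below to $\mathbb Z_p$. An issuer key is $pk=(w,B,B_0,B_1)$ with $w\in\mathbb G_2$ and generators $B,B_0,B_1$ of $\mathbb G_1$; an honest issuer has $w=h^{sk}$. A credential $(A,e,s)$ is valid for key $x$ and attribute $a$ if $\hat e(A,h^e w)=\hat e(gB^sB_0^xB_1^a,h)$. **The BBS+ threshold protocol (TCP).** A user with shares $x_U,x_S$ of her key $x=x_U+x_S$ runs it with a central server TS and a service provider SP, on input "issue $a$" or "show $a$". She picks $\mu\in_R\mathbb Z_p$, sends $\tilde x_S=x_S+\mu$ and the mode (issuance or showing) to the TS, and puts $\tilde x_U=x_U-\mu$. *Issue $a$.* She sends $B_0$ to the TS and gets $V$ back (honestly $V=B_0^{\tilde x_S}$), picks $s'\in_R\mathbb Z_p$, puts $U=B^{s'}B_0^{\tilde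 x_U}V$ and sends $U$, $a$ and her identification data (see below) to the SP, which returns a nonce in $\{0,1\}^{128}$. She picks $t_U,\hat s'\in_R\mathbb Z_p$ and sends $B_0$, $\mathsf{ctx}=(U,B,B_0)$, the nonce and $\tilde U'=B^{\hat s'}B_0^{t_U}$ to the TS. The TS returns $(\tilde U,r_S)$; the honest TS picks $t_S\in_R\mathbb Z_p$ and computes $\tilde U=\tilde U'B_0^{t_S}$, $c=H(\tilde U,\mathsf{ctx},\mathsf{nonce})$, $r_S=t_S+c\tilde x_S$. The user recomputes $c$ from the received $\tilde U$ and sends $(c,\ \hat s'+cs',\ r)$ with $r=t_U+c\tilde x_U+r_S$ to the SP. The honest SP checks, writing the last two entries as $s_{s'},r$, that $c=H(U^{-c}B^{s_{s'}}B_0^{r},\mathsf{ctx},\mathsf{nonce})$, picks $s'',e\in_R\mathbb Z_p$, and returns $A=(gB^{s''}UB_1^{a})^{1/(e+sk)}$, $e$, $s''$. The user stores $(A,e,s'+s'')$ as her credential for $a$ if it is valid for $x$ and $a$. *Show $a$.* A user who holds no credential for $a$ does nothing. Otherwise, with her credential $(A,e,s)$, she picks $r_1,r_2\in_R\mathbb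 Z_p$, puts $C_1=Ag_2^{r_1}$, $C_2=g_1^{r_1}g_2^{r_2}$, $\alpha_1=er_1$, $\alpha_2=er_2$, sends her identification data and $\mathsf{ctx}=(pk,C_1,C_2,a)$ to the SP, and gets a nonce. She commits with random exponents $k_\bullet$ to $E_1=g_1^{k_{r_1}}g_2^{k_{r_2}}$, $E_2=g_1^{k_{\alpha_1}}g_2^{k_{\alpha_2}}C_2^{-k_e}$, $E_3'=\hat e(B,h)^{k_s}\hat e(B_0,h)^{k_x}\hat e(g_2,w)^{k_{r_1}}\hat e(g_2,h)^{k_{\alpha_1}}\hat e(C_1,h)^{-k_e}$, and sends $\hat e(B_0,h),\mathsf{ctx},\mathsf{nonce},E_1,E_2,E_3'$ to the TS. The TS returns $(E_3,r_S)$; honestly $E_3=E_3'\hat e(B_0,h)^{t_S}$ with $t_S\in_R\mathbb Z_p$, $c=H(E_1,E_2,E_3,\mathsf{ctx},\mathsf{nonce})$, $r_S=t_S+c\tilde x_S$. The user recomputes $c$ and sends to the SP $c$ and the responses $k_v+cv$ for $v\in\{r_1,r_2,\alpha_1,\alpha_2,e,s\}$ and $k_x+c\tilde x_U+r_S$. The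 honest SP verifies this proof of knowledge of $C_2=g_1^{r_1}g_2^{r_2}$, $C_2^e=g_1^{\alpha_1}g_2^{\alpha_2}$ and $\hat e(C_1,w)\hat e(C_1,h)^e=\hat e(g,h)\hat e(B,h)^s\hat e(B_0,h)^x\hat e(B_1,h)^a\hat e(g_2,w)^{r_1}\hat e(g_2,h)^{\alpha_1}$. A TS or SP that deviates may return anything, or refuse to continue. *Identification data*: in a run on input $\mathsf{aux}$, user $U_i$ sends to the SP (and not to the TS) a fresh sample of an arbitrary distribution $I_i(\mathsf{aux})$; thus the SP may or may not be able to tell users apart. **TCP privacy game.** Setup: there are users $U_0,U_1$; the challenger picks $x_{U,0},x_{U,1}\in_R\mathbb Z_p$, and whoever plays the TS chooses $x_{S,0},x_{S,1}$ (an honest TS: uniformly). Queries: the adversary adaptively makes finitely many (a number bounded in advance) queries $\mathsf{RunTCP}(i,\mathsf{aux})$, upon which $U_i$ runs the protocol. Challenge: the adversary outputs $\mathsf{aux}$; if this is "show $a$", both users must hold a credential for $a$, otherwise the adversary loses. For $b\in_R\{0,1\}$ first $U_b$ and then $U_{1-b}$ runs the protocol on $\mathsf{aux}$. Guess: the adversary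 outputs $b'$ and wins if $b'=b$. There are three versions: * *honest SP*: the adversary plays the TS; the SP is honest, with an issuer key that is fixed arbitrarily, and after every message the adversary may moreover interact with the SP as a normal user, in any number of concurrent sessions (a number of requests bounded in advance); * *colluding SP*: the adversary plays both TS and SP and chooses the issuer key; * *SP alone*: the adversary plays the SP and chooses the issuer key; the TS is honest. Adversaries are probabilistic and computationally unbounded. **Theorem.** For all such parameters, all $H$ and all $I_0,I_1$: 1. Every adversary wins the TCP privacy game with honest SP with probability at most $1/2$, even if the SP can identify the users. 2. If the issuance and showing runs do not identify the user to the SP, then the protocol is private against colluding SPs: for every real $\varepsilon$, if every adversary wins the game with SP alone with probability at most $1/2+\varepsilon$, then every adversary wins the game with colluding SP with probability at most $1/2+\varepsilon$. 3. The implication in 2 also holds adversary by adversary, hence for adversaries of restricted power: the winning probability of any adversary $\mathcal A$ in the game with colluding SP is at most that of the adversary $\mathcal A^{\mathrm{SP}}$ in the game with SP alone. Here $\mathcal A^{\mathrm{SP}}$ runs one copy of $\mathcal A$, makes the same queries, the same challenge and the same guess, plays towards $\mathcal A$ two users with shares $x_U$ of its own (in the challenge first $U_0$, then $U_1$), forwards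 to $\mathcal A$ only the identification data and the input of each run, and issues, under the issuer key $(h,g,g,g)$, a credential for $a$ to the real user exactly if the user played towards $\mathcal A$ holds one. In particular, in a family of parameters in which these honest computations take polynomial time, if no polynomial-time SP alone wins with probability non-negligibly better than $1/2$, then neither does any polynomial-time coalition of TS and SP. -/

import Mathlib

/-!
Groups are written additively: a group of prime order `p` is a `ZMod p`-module with `p` elements,
and `a • X` is the power `X ^ a` of multiplicative notation.
Probabilistic algorithms are `PMF`-valued functions, interactive parties are state machines.
-/

namespace ThresholdBBS

noncomputable section

/-- The nonces of the protocol: `{0,1}^128`. -/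
abbrev Nonce : Type := Fin 128 → Bool

/-- The two modes of the server-side protocol. -/
inductive Mode : Type
  | issuance
  | showing

/-- The input of a user to a run: get a credential with attribute `a` issued, or show
a credential while disclosing its attribute `a`. -/
inductive Aux (p : ℕ) : Type
  | issue (a : ZMod p)
  | present (a : ZMod p)

/-- An issuer public key; `B`, `B₀`, `B₁` are generators. -/
structure PublicKey (G₁ G₂ : Type) [AddCommGroup G₁] : Type where
  w : G₂
  B : G₁
  B₀ : G₁
  B₁ : G₁
  B_ne : B ≠ 0
  B₀_ne : B₀ ≠ 0
  B₁_ne : B₁ ≠ 0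

/-- The context `U ‖ B ‖ B₀` of an issuance proof. -/
structure IssueCtx (G₁ : Type) : Type where
  U : G₁
  B : G₁
  B₀ : G₁

/-- The context of a showing proof: the bases and the statement. The remaining bases are
system parameters. -/
structure ShowCtx (p : ℕ) (G₁ G₂ : Type) [AddCommGroup G₁] : Type where
  pk : PublicKey G₁ G₂
  C₁ : G₁
  C₂ : G₁
  a : ZMod p

/-- The inputs `Ũ ‖ ctx ‖ nonce` and `E₁ ‖ E₂ ‖ E₃ ‖ ctx ‖ nonce` of the hash function. -/
inductive HashInput (p : ℕ) (G₁ G₂ GT : Type) [AddCommGroup G₁] : Type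
  | issuance (Utilde : G₁) (ctx : IssueCtx G₁) (nonce : Nonce)
  | showing (E₁ E₂ : G₁) (E₃ : GT) (ctx : ShowCtx p G₁ G₂) (nonce : Nonce)

/-- Public parameters: a bilinear group pair of prime order `p` with generators `g`, `h` and
a nondegenerate pairing, auxiliary generators `g₁`, `g₂` of the first group, and a hash function
to `ZMod p`. -/
structure Params (p : ℕ) [Fact p.Prime] (G₁ G₂ GT : Type)
    [AddCommGroup G₁] [Module (ZMod p) G₁] [AddCommGroup G₂] [Module (ZMod p) G₂]
    [AddCommGroup GT] [Module (ZMod p) GT] : Type where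
  card_G₁ : Nat.card G₁ = p
  card_G₂ : Nat.card G₂ = p
  card_GT : Nat.card GT = p
  g : G₁
  h : G₂
  g₁ : G₁
  g₂ : G₁
  g_ne : g ≠ 0
  h_ne : h ≠ 0
  g₁_ne : g₁ ≠ 0
  g₂_ne : g₂ ≠ 0
  pair : G₁ →ₗ[ZMod p] G₂ →ₗ[ZMod p] GT
  pair_ne : pair g h ≠ 0
  H : HashInput p G₁ G₂ GT → ZMod p

/-- A BBS+ credential `(A, e, s)`. -/
structure Credential (p : ℕ) (G₁ : Type) : Type where
  A : G₁
  e : ZMod p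
  s : ZMod p

/-- A user's long-term state: her key share, the server's share of her key (she receives it in
the setup of the game), and her current credential for each attribute value, if any. -/
structure User (p : ℕ) (G₁ : Type) : Type where
  xU : ZMod p
  xS : ZMod p
  creds : ZMod p → Option (Credential p G₁)

/-- A freshly registered user. -/
def User.fresh {p : ℕ} {G₁ : Type} (xU xS : ZMod p) : User p G₁ := ⟨xU, xS, fun _ => none⟩

/-- A user can always run issuance; she can show an attribute value if she holds a credential
for it. -/
def User.CanRun {p : ℕ} {G₁ : Type} (u : User p G₁) : Aux p → Prop
  | .issue _ => True
  | .present a => u.creds a ≠ none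

/-- What the user sends to the server in step 1 of an issuance. -/
structure IssueRequest (G₁ : Type) : Type where
  B₀ : G₁
  ctx : IssueCtx G₁
  nonce : Nonce
  Upartial : G₁

/-- What the user sends to the server in step 1 of a showing. -/
structure ShowRequest (p : ℕ) (G₁ G₂ GT : Type) [AddCommGroup G₁] : Type where
  base : GT
  ctx : ShowCtx p G₁ G₂
  nonce : Nonce
  E₁ : G₁
  E₂ : G₁
  E₃partial : GT

/-- The proof `(c, s_{s'}, r)` that the user sends to the issuer. -/
structure IssueProof (p : ℕ) : Type where
  c : ZMod p
  zs : ZMod p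
  zx : ZMod p

/-- The challenge and the responses that the user sends to the verifier in a showing. -/
structure ShowProof (p : ℕ) : Type where
  c : ZMod p
  zr₁ : ZMod p
  zr₂ : ZMod p
  zα₁ : ZMod p
  zα₂ : ZMod p
  ze : ZMod p
  zx : ZMod p
  zs : ZMod p

/-- The strategy of whoever plays the central server TS towards a user, with state in `W`.
A reply `none` means that the server refuses to go on. -/
structure TSRole (p : ℕ) (G₁ G₂ GT : Type) [AddCommGroup G₁] (W : Type) : Type where
  /-- receives the randomized key share and the mode -/
  start : W → ZMod p → Mode → PMF W
  /-- receives `B₀`, is meant to return the power of `B₀` to the randomized share -/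
  base : W → G₁ → PMF (W × Option G₁)
  /-- receives step 1 of an issuance, returns `Ũ` and `r_S` -/
  issue : W → IssueRequest G₁ → PMF (W × Option (G₁ × ZMod p))
  /-- receives step 1 of a showing, returns `E₃` and `r_S` -/
  present : W → ShowRequest p G₁ G₂ GT → PMF (W × Option (GT × ZMod p))

/-- The strategy of whoever plays the service provider SP (issuer and verifier) towards a user.
`D` is the type of the data by which users may identify themselves to the SP. -/
structure SPRole (p : ℕ) (G₁ G₂ D : Type) [AddCommGroup G₁] (W : Type) : Type where
  /-- receives the identification data, the requested attribute and `U`, returns a nonce -/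
  openIssue : W → D → ZMod p → G₁ → PMF (W × Option Nonce)
  /-- receives the proof about `U` in the session with this nonce, returns `(A, e, s'')` -/
  issue : W → ZMod p → G₁ → Nonce → IssueProof p → PMF (W × Option (G₁ × ZMod p × ZMod p))
  /-- receives the identification data and the statement to be proven, returns a nonce -/
  openShow : W → D → ShowCtx p G₁ G₂ → PMF (W × Option Nonce)
  /-- receives the proof in the session with this nonce, returns a verdict -/
  verify : W → ShowCtx p G₁ G₂ → Nonce → ShowProof p → PMF (W × Bool)

/-- The adversary's side of the game outside of protocol runs. -/
structure Driver (p : ℕ) (W : Type) : Type where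
  /-- a bound on the number of queries -/
  queryBound : ℕ
  /-- the next query: a user and her input; `none` ends the query phase -/
  next : W → PMF (W × Option (Bool × Aux p))
  /-- the input for the challenge -/
  challenge : W → PMF (W × Aux p)
  /-- the guess for the challenge bit -/
  guess : W → PMF Bool

section Protocol

variable {p : ℕ} [Fact p.Prime] {G₁ G₂ GT D W : Type}
  [AddCommGroup G₁] [Module (ZMod p) G₁] [AddCommGroup G₂] [Module (ZMod p) G₂]
  [AddCommGroup GT] [Module (ZMod p) GT]

/-- A uniformly random element of `ZMod p`. -/
def unif (p : ℕ) [Fact p.Prime] : PMF (ZMod p) := PMF.uniformOfFintype (ZMod p)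

/-- `cred` is a valid BBS+ signature under `pk` on the key `x` and the attribute `a`. -/
def ValidCred (P : Params p G₁ G₂ GT) (pk : PublicKey G₁ G₂) (x a : ZMod p)
    (cred : Credential p G₁) : Prop :=
  P.pair cred.A (cred.e • P.h + pk.w) =
    P.pair (P.g + cred.s • pk.B + x • pk.B₀ + a • pk.B₁) P.h

open Classical in
/-- The user's side of an issuance. She keeps the credential if it is valid. -/
def runIssue (P : Params p G₁ G₂ GT) (pk : PublicKey G₁ G₂)
    (ts : TSRole p G₁ G₂ GT W) (sp : SPRole p G₁ G₂ D W) (ident : PMF D)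
    (u : User p G₁) (a : ZMod p) (w₀ : W) : PMF (W × User p G₁) := do
  let μ ← unif p
  let xtS := u.xS + μ
  let xtU := u.xU - μ
  let w₁ ← ts.start w₀ xtS .issuance
  let (w₂, V?) ← ts.base w₁ pk.B₀
  match V? with
  | none => pure (w₂, u)
  | some V =>
    let s₁ ← unif p
    let U := s₁ • pk.B + xtU • pk.B₀ + V
    let d ← ident
    let (w₃, nonce?) ← sp.openIssue w₂ d a U
    match nonce? with
    | none => pure (w₃, u)
    | some nonce =>
      let tU ← unif p
      let k ← unif p
      let ctx : IssueCtx G₁ := ⟨U, pk.B, pk.B₀⟩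
      let (w₄, reply?) ← ts.issue w₃ ⟨pk.B₀, ctx, nonce, k • pk.B + tU • pk.B₀⟩
      match reply? with
      | none => pure (w₄, u)
      | some (Utilde, rS) =>
        let c := P.H (.issuance Utilde ctx nonce)
        let (w₅, sig?) ← sp.issue w₄ a U nonce ⟨c, k + c * s₁, tU + c * xtU + rS⟩
        match sig? with
        | none => pure (w₅, u)
        | some (A, e, s₂) =>
          let cred : Credential p G₁ := ⟨A, e, s₁ + s₂⟩
          if ValidCred P pk (u.xU + u.xS) a cred then
            pure (w₅, { u with creds := Function.update u.creds a (some cred) })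
          else pure (w₅, u)

/-- The user's side of a showing of the credential `cred` with disclosed attribute `a`. -/
def runShow (P : Params p G₁ G₂ GT) (pk : PublicKey G₁ G₂)
    (ts : TSRole p G₁ G₂ GT W) (sp : SPRole p G₁ G₂ D W) (ident : PMF D)
    (u : User p G₁) (a : ZMod p) (cred : Credential p G₁) (w₀ : W) : PMF W := do
  let μ ← unif p
  let xtS := u.xS + μ
  let xtU := u.xU - μ
  let w₁ ← ts.start w₀ xtS .showing
  let r₁ ← unif p
  let r₂ ← unif p
  let α₁ := cred.e * r₁
  let α₂ := cred.e * r₂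
  let C₁ := cred.A + r₁ • P.g₂
  let C₂ := r₁ • P.g₁ + r₂ • P.g₂
  let ctx : ShowCtx p G₁ G₂ := ⟨pk, C₁, C₂, a⟩
  let d ← ident
  let (w₂, nonce?) ← sp.openShow w₁ d ctx
  match nonce? with
  | none => pure w₂
  | some nonce =>
    let kr₁ ← unif p
    let kr₂ ← unif p
    let kα₁ ← unif p
    let kα₂ ← unif p
    let ke ← unif p
    let kx ← unif p
    let ks ← unif p
    let E₁ := kr₁ • P.g₁ + kr₂ • P.g₂
    let E₂ := kα₁ • P.g₁ + kα₂ • P.g₂ - ke • C₂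
    let E₃p := ks • P.pair pk.B P.h + kx • P.pair pk.B₀ P.h + kr₁ • P.pair P.g₂ pk.w
      + kα₁ • P.pair P.g₂ P.h - ke • P.pair C₁ P.h
    let (w₃, reply?) ← ts.present w₂ ⟨P.pair pk.B₀ P.h, ctx, nonce, E₁, E₂, E₃p⟩
    match reply? with
    | none => pure w₃
    | some (E₃, rS) =>
      let c := P.H (.showing E₁ E₂ E₃ ctx nonce)
      let (w₄, _) ← sp.verify w₃ ctx nonce
        ⟨c, kr₁ + c * r₁, kr₂ + c * r₂, kα₁ + c * α₁, kα₂ + c * α₂, ke + c * cred.e,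
          kx + c * xtU + rS, ks + c * cred.s⟩
      pure w₄

/-- One complete run of the threshold protocol by a user. A user who is asked to show an
attribute for which she holds no credential does nothing. -/
def runTCP (P : Params p G₁ G₂ GT) (pk : PublicKey G₁ G₂)
    (ts : TSRole p G₁ G₂ GT W) (sp : SPRole p G₁ G₂ D W) (ident : PMF D)
    (u : User p G₁) (aux : Aux p) (w : W) : PMF (W × User p G₁) :=
  match aux with
  | .issue a => runIssue P pk ts sp ident u a w
  | .present a =>
    match u.creds a with
    | none => pure (w, u)
    | some cred => do
      let w₁ ← runShow P pk ts sp ident u a cred w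
      pure (w₁, u)

/-- The honest server-side protocol `TCP.TS`; the second component of the state holds the
randomized share it works with. -/
def honestTS (P : Params p G₁ G₂ GT) (W : Type) : TSRole p G₁ G₂ GT (W × ZMod p) where
  start w x _ := pure (w.1, x)
  base w B₀ := pure (w, some (w.2 • B₀))
  issue w req := do
    let tS ← unif p
    let Utilde := req.Upartial + tS • req.B₀
    let c := P.H (.issuance Utilde req.ctx req.nonce)
    pure (w, some (Utilde, tS + c * w.2))
  present w req := do
    let tS ← unif p
    let E₃ := req.E₃partial + tS • req.base
    let c := P.H (.showing req.E₁ req.E₂ E₃ req.ctx req.nonce)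
    pure (w, some (E₃, tS + c * w.2))

/-- The issuer's key pair. -/
structure IssuerKey (p : ℕ) (G₁ : Type) [AddCommGroup G₁] : Type where
  sk : ZMod p
  B : G₁
  B₀ : G₁
  B₁ : G₁
  B_ne : B ≠ 0
  B₀_ne : B₀ ≠ 0
  B₁_ne : B₁ ≠ 0

/-- The public key that belongs to an issuer's key pair. -/
def IssuerKey.pk (ik : IssuerKey p G₁) (P : Params p G₁ G₂ GT) : PublicKey G₁ G₂ :=
  ⟨ik.sk • P.h, ik.B, ik.B₀, ik.B₁, ik.B_ne, ik.B₀_ne, ik.B₁_ne⟩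

/-- The issuer's check of the proof that `U` is well-formed. -/
def IssueAccepts (P : Params p G₁ G₂ GT) (pk : PublicKey G₁ G₂) (U : G₁) (nonce : Nonce)
    (π : IssueProof p) : Prop :=
  π.c = P.H (.issuance (π.zs • pk.B + π.zx • pk.B₀ - π.c • U) ⟨U, pk.B, pk.B₀⟩ nonce)

/-- The verifier's check of a showing proof. -/
def ShowAccepts (P : Params p G₁ G₂ GT) (ctx : ShowCtx p G₁ G₂) (nonce : Nonce)
    (π : ShowProof p) : Prop :=
  π.c = P.H (.showing
    (π.zr₁ • P.g₁ + π.zr₂ • P.g₂ - π.c • ctx.C₂)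
    (π.zα₁ • P.g₁ + π.zα₂ • P.g₂ - π.ze • ctx.C₂)
    (π.zs • P.pair ctx.pk.B P.h + π.zx • P.pair ctx.pk.B₀ P.h + π.zr₁ • P.pair P.g₂ ctx.pk.w
      + π.zα₁ • P.pair P.g₂ P.h - π.ze • P.pair ctx.C₁ P.h
      - π.c • (P.pair ctx.C₁ ctx.pk.w - P.pair P.g P.h - ctx.a • P.pair ctx.pk.B₁ P.h))
    ctx nonce)

open Classical in
/-- The honest issuer: checks the proof and signs. -/
def issuerReply (P : Params p G₁ G₂ GT) (ik : IssuerKey p G₁) (a : ZMod p) (U : G₁)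
    (nonce : Nonce) (π : IssueProof p) : PMF (Option (G₁ × ZMod p × ZMod p)) :=
  if IssueAccepts P (ik.pk P) U nonce π then do
    let s₂ ← unif p
    let e ← unif p
    pure (some ((e + ik.sk)⁻¹ • (P.g + s₂ • ik.B + U + a • ik.B₁), e, s₂))
  else pure none

open Classical in
/-- The honest service provider in runs with the honest users. -/
def honestSP (P : Params p G₁ G₂ GT) (ik : IssuerKey p G₁) (D W : Type) :
    SPRole p G₁ G₂ D W where
  openIssue w _ _ _ := do
    let nonce ← PMF.uniformOfFintype Nonce
    pure (w, some nonce)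
  issue w a U nonce π := do
    let reply ← issuerReply P ik a U nonce π
    pure (w, reply)
  openShow w _ _ := do
    let nonce ← PMF.uniformOfFintype Nonce
    pure (w, some nonce)
  verify w ctx nonce π := pure (w, decide (ShowAccepts P ctx nonce π))

/-- The query phase, with at most `n` further queries. -/
def queryPhase (P : Params p G₁ G₂ GT) (pk : PublicKey G₁ G₂)
    (ts : TSRole p G₁ G₂ GT W) (sp : SPRole p G₁ G₂ D W) (drv : Driver p W)
    (ident : Bool → Aux p → PMF D) :
    ℕ → W → (Bool → User p G₁) → PMF (W × (Bool → User p G₁))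
  | 0, w, us => pure (w, us)
  | n + 1, w, us => do
    let (w₁, query?) ← drv.next w
    match query? with
    | none => pure (w₁, us)
    | some (i, aux) =>
      let (w₂, u) ← runTCP P pk ts sp (ident i aux) (us i) aux w₁
      queryPhase P pk ts sp drv ident n w₂ (Function.update us i u)

open Classical in
/-- The phases of the privacy game after the setup; the result says whether the adversary wins.
The users are `U₀ = us false` and `U₁ = us true`. A challenge is only admitted if both users
can run the protocol on the chosen input; otherwise the adversary loses. -/
def privacyGame (P : Params p G₁ G₂ GT) (pk : PublicKey G₁ G₂)
    (ts : TSRole p G₁ G₂ GT W) (sp : SPRole p G₁ G₂ D W) (drv : Driver p W)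
    (ident : Bool → Aux p → PMF D) (w₀ : W) (us₀ : Bool → User p G₁) : PMF Bool := do
  let (w₁, us) ← queryPhase P pk ts sp drv ident drv.queryBound w₀ us₀
  let (w₂, aux) ← drv.challenge w₁
  if (us false).CanRun aux ∧ (us true).CanRun aux then
    let b ← PMF.uniformOfFintype Bool
    let (w₃, _) ← runTCP P pk ts sp (ident b aux) (us b) aux w₂
    let (w₄, _) ← runTCP P pk ts sp (ident (!b) aux) (us (!b)) aux w₃
    let guess ← drv.guess w₄
    pure (guess == b)
  else pure false

end Protocol

/-! ### Colluding SP: the adversary plays TS and SP -/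

/-- An adversary that plays both TS and SP. In the setup it publishes the issuer key
and fixes the server's shares of the users' keys. -/
structure CoalitionAdversary (p : ℕ) (G₁ G₂ GT D : Type) [AddCommGroup G₁] where
  State : Type
  init : PMF (State × PublicKey G₁ G₂ × (Bool → ZMod p))
  ts : TSRole p G₁ G₂ GT State
  sp : SPRole p G₁ G₂ D State
  driver : Driver p State

/-- An adversary that plays only SP. -/
structure SPAdversary (p : ℕ) (G₁ G₂ D : Type) [AddCommGroup G₁] where
  State : Type
  init : PMF (State × PublicKey G₁ G₂)
  sp : SPRole p G₁ G₂ D State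
  driver : Driver p State

/-- A strategy of SP leaves the other component of the state alone. -/
def SPRole.lift {p : ℕ} {G₁ G₂ D S : Type} [AddCommGroup G₁] (R : SPRole p G₁ G₂ D S)
    (T : Type) : SPRole p G₁ G₂ D (S × T) where
  openIssue w d a U := (R.openIssue w.1 d a U).map fun r => ((r.1, w.2), r.2)
  issue w a U nonce π := (R.issue w.1 a U nonce π).map fun r => ((r.1, w.2), r.2)
  openShow w d ctx := (R.openShow w.1 d ctx).map fun r => ((r.1, w.2), r.2)
  verify w ctx nonce π := (R.verify w.1 ctx nonce π).map fun r => ((r.1, w.2), r.2)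

/-- A driver that leaves the other component of the state alone. -/
def Driver.lift {p : ℕ} {S : Type} (R : Driver p S) (T : Type) : Driver p (S × T) where
  queryBound := R.queryBound
  next w := (R.next w.1).map fun r => ((r.1, w.2), r.2)
  challenge w := (R.challenge w.1).map fun r => ((r.1, w.2), r.2)
  guess w := R.guess w.1

/-! ### Honest SP: the adversary plays TS, and talks to the SP as a normal user -/

/-- A session of the honest SP with the adversary, which acts as a normal user. -/
inductive Session (p : ℕ) (G₁ G₂ : Type) [AddCommGroup G₁] : Type
  | issuing (a : ZMod p) (U : G₁) (nonce : Nonce)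
  | showing (ctx : ShowCtx p G₁ G₂) (nonce : Nonce)
  | closed

/-- What a normal user can send to SP; `k` is a session number. -/
inductive SPRequest (p : ℕ) (G₁ : Type) : Type
  | openIssue (a : ZMod p) (U : G₁)
  | openShow (a : ZMod p) (C₁ C₂ : G₁)
  | issue (k : ℕ) (π : IssueProof p)
  | verify (k : ℕ) (π : ShowProof p)

/-- What SP answers to a normal user. -/
inductive SPReply (p : ℕ) (G₁ : Type) : Type
  | session (k : ℕ) (nonce : Nonce)
  | signature (sig : Option (G₁ × ZMod p × ZMod p))
  | verdict (accepted : Bool)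

/-- The messages that TS receives from users. -/
inductive TSMessage (p : ℕ) (G₁ G₂ GT : Type) [AddCommGroup G₁] : Type
  | start (x : ZMod p) (m : Mode)
  | base (B₀ : G₁)
  | issue (req : IssueRequest G₁)
  | present (req : ShowRequest p G₁ G₂ GT)

/-- An adversary that plays TS against honest users and an honest SP. After every message that
it receives, and before each of its other moves, it may send up to `askBound` requests to SP. -/
structure HonestSPAdversary (p : ℕ) (G₁ G₂ GT : Type) [AddCommGroup G₁] where
  State : Type
  /-- the initial state and the server's shares of the users' keys -/
  init : PMF (State × (Bool → ZMod p))
  recv : State → TSMessage p G₁ G₂ GT → PMF State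
  replyBase : State → PMF (State × Option G₁)
  replyIssue : State → PMF (State × Option (G₁ × ZMod p))
  replyShow : State → PMF (State × Option (GT × ZMod p))
  askBound : ℕ
  ask : State → PMF (State × Option (SPRequest p G₁))
  onReply : State → SPReply p G₁ → PMF State
  driver : Driver p State

section Games

variable {p : ℕ} [Fact p.Prime] {G₁ G₂ GT D : Type}
  [AddCommGroup G₁] [Module (ZMod p) G₁] [AddCommGroup G₂] [Module (ZMod p) G₂]
  [AddCommGroup GT] [Module (ZMod p) GT]

open Classical in
/-- The honest SP serving a normal user; it uses every nonce for one proof only. -/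
def serveUser (P : Params p G₁ G₂ GT) (ik : IssuerKey p G₁) (ss : List (Session p G₁ G₂)) :
    SPRequest p G₁ → PMF (List (Session p G₁ G₂) × SPReply p G₁)
  | .openIssue a U => do
    let nonce ← PMF.uniformOfFintype Nonce
    pure (ss ++ [.issuing a U nonce], .session ss.length nonce)
  | .openShow a C₁ C₂ => do
    let nonce ← PMF.uniformOfFintype Nonce
    pure (ss ++ [.showing ⟨ik.pk P, C₁, C₂, a⟩ nonce], .session ss.length nonce)
  | .issue k π =>
    match ss[k]? with
    | some (.issuing a U nonce) => do
      let sig ← issuerReply P ik a U nonce π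
      pure (ss.set k .closed, .signature sig)
    | _ => pure (ss, .signature none)
  | .verify k π =>
    match ss[k]? with
    | some (.showing ctx nonce) =>
      pure (ss.set k .closed, .verdict (decide (ShowAccepts P ctx nonce π)))
    | _ => pure (ss, .verdict false)

namespace HonestSPAdversary

/-- The adversary's state together with the SP's sessions with the adversary. -/
abbrev World (𝒜 : HonestSPAdversary p G₁ G₂ GT) : Type := 𝒜.State × List (Session p G₁ G₂)

/-- The adversary talks to SP, with at most `n` requests. -/
def talk (P : Params p G₁ G₂ GT) (ik : IssuerKey p G₁) (𝒜 : HonestSPAdversary p G₁ G₂ GT) :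
    ℕ → 𝒜.World → PMF 𝒜.World
  | 0, w => pure w
  | n + 1, w => do
    let (st, req?) ← 𝒜.ask w.1
    match req? with
    | none => pure (st, w.2)
    | some req =>
      let (ss, reply) ← serveUser P ik w.2 req
      let st₁ ← 𝒜.onReply st reply
      talk P ik 𝒜 n (st₁, ss)

/-- The adversary receives a message from a user and then talks to SP. -/
def receive (P : Params p G₁ G₂ GT) (ik : IssuerKey p G₁) (𝒜 : HonestSPAdversary p G₁ G₂ GT)
    (w : 𝒜.World) (m : TSMessage p G₁ G₂ GT) : PMF 𝒜.World := do
  let st ← 𝒜.recv w.1 m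
  talk P ik 𝒜 𝒜.askBound (st, w.2)

/-- The adversary in the role of TS. -/
def ts (P : Params p G₁ G₂ GT) (ik : IssuerKey p G₁) (𝒜 : HonestSPAdversary p G₁ G₂ GT) :
    TSRole p G₁ G₂ GT 𝒜.World where
  start w x m := receive P ik 𝒜 w (.start x m)
  base w B₀ := do
    let w₁ ← receive P ik 𝒜 w (.base B₀)
    let (st, reply) ← 𝒜.replyBase w₁.1
    pure ((st, w₁.2), reply)
  issue w req := do
    let w₁ ← receive P ik 𝒜 w (.issue req)
    let (st, reply) ← 𝒜.replyIssue w₁.1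
    pure ((st, w₁.2), reply)
  present w req := do
    let w₁ ← receive P ik 𝒜 w (.present req)
    let (st, reply) ← 𝒜.replyShow w₁.1
    pure ((st, w₁.2), reply)

/-- The adversary's moves outside of protocol runs, each preceded by a talk with SP. -/
def worldDriver (P : Params p G₁ G₂ GT) (ik : IssuerKey p G₁)
    (𝒜 : HonestSPAdversary p G₁ G₂ GT) : Driver p 𝒜.World where
  queryBound := 𝒜.driver.queryBound
  next w := do
    let w₁ ← talk P ik 𝒜 𝒜.askBound w
    let (st, query) ← 𝒜.driver.next w₁.1
    pure ((st, w₁.2), query)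
  challenge w := do
    let w₁ ← talk P ik 𝒜 𝒜.askBound w
    let (st, aux) ← 𝒜.driver.challenge w₁.1
    pure ((st, w₁.2), aux)
  guess w := do
    let w₁ ← talk P ik 𝒜 𝒜.askBound w
    𝒜.driver.guess w₁.1

/-- The TCP privacy game with honest SP. -/
def game (P : Params p G₁ G₂ GT) (ident : Bool → Aux p → PMF D) (ik : IssuerKey p G₁)
    (𝒜 : HonestSPAdversary p G₁ G₂ GT) : PMF Bool := do
  let (st, xS) ← 𝒜.init
  let xU₀ ← unif p
  let xU₁ ← unif p
  privacyGame P (ik.pk P) (𝒜.ts P ik) (honestSP P ik D 𝒜.World) (𝒜.worldDriver P ik) ident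
    (st, []) (fun i => User.fresh (if i then xU₁ else xU₀) (xS i))

/-- The probability that the adversary wins the TCP privacy game with honest SP. -/
def winProb (P : Params p G₁ G₂ GT) (ident : Bool → Aux p → PMF D) (ik : IssuerKey p G₁)
    (𝒜 : HonestSPAdversary p G₁ G₂ GT) : ℝ := (𝒜.game P ident ik true).toReal

end HonestSPAdversary

/-- The TCP privacy game with colluding SP. -/
def CoalitionAdversary.game (P : Params p G₁ G₂ GT) (ident : Bool → Aux p → PMF D)
    (𝒜 : CoalitionAdversary p G₁ G₂ GT D) : PMF Bool := do
  let (st, pk, xS) ← 𝒜.init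
  let xU₀ ← unif p
  let xU₁ ← unif p
  privacyGame P pk 𝒜.ts 𝒜.sp 𝒜.driver ident st
    (fun i => User.fresh (if i then xU₁ else xU₀) (xS i))

/-- The probability that the adversary wins the TCP privacy game with colluding SP. -/
def CoalitionAdversary.winProb (P : Params p G₁ G₂ GT) (ident : Bool → Aux p → PMF D)
    (𝒜 : CoalitionAdversary p G₁ G₂ GT D) : ℝ := (𝒜.game P ident true).toReal

/-- The same game against the SP alone: the TS is honest. -/
def SPAdversary.game (P : Params p G₁ G₂ GT) (ident : Bool → Aux p → PMF D)
    (ℬ : SPAdversary p G₁ G₂ D) : PMF Bool := do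
  let (st, pk) ← ℬ.init
  let xU₀ ← unif p
  let xU₁ ← unif p
  let xS₀ ← unif p
  let xS₁ ← unif p
  privacyGame P pk (honestTS P ℬ.State) (ℬ.sp.lift (ZMod p)) (ℬ.driver.lift (ZMod p)) ident
    (st, 0) (fun i => User.fresh (if i then xU₁ else xU₀) (if i then xS₁ else xS₀))

/-- The probability that an SP without access to the TS wins the game. -/
def SPAdversary.winProb (P : Params p G₁ G₂ GT) (ident : Bool → Aux p → PMF D)
    (ℬ : SPAdversary p G₁ G₂ D) : ℝ := (ℬ.game P ident true).toReal

end Games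
/-! ### A coalition adversary used by the SP alone -/

/-- The state of an SP adversary that runs a coalition adversary: the state of the latter, the
issuer key that it published, two users played towards it, and the user of the coming run. -/
structure SimState (p : ℕ) (G₁ G₂ S : Type) [AddCommGroup G₁] : Type where
  st : S
  pk : PublicKey G₁ G₂
  users : Bool → User p G₁
  cur : Bool

section Simulation

variable {p : ℕ} [Fact p.Prime] {G₁ G₂ GT D : Type}
  [AddCommGroup G₁] [Module (ZMod p) G₁] [AddCommGroup G₂] [Module (ZMod p) G₂]
  [AddCommGroup GT] [Module (ZMod p) GT]

/-- The simulated user of the coming run performs it with the coalition adversary, using `d` as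
identification data. -/
def CoalitionAdversary.simRun (P : Params p G₁ G₂ GT) (𝒜 : CoalitionAdversary p G₁ G₂ GT D)
    (d : D) (aux : Aux p) (w : SimState p G₁ G₂ 𝒜.State) : PMF (SimState p G₁ G₂ 𝒜.State) := do
  let (st, u) ← runTCP P w.pk 𝒜.ts 𝒜.sp (pure d) (w.users w.cur) aux w.st
  pure ⟨st, w.pk, Function.update w.users w.cur u, !w.cur⟩

/-- The SP adversary that runs the coalition adversary `𝒜` once, playing two honest users with
keys of its own towards it. From the runs in which it takes part it passes on to `𝒜` only the
identification data and the input. As an issuer it uses the secret key `1`, and it issues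
credentials exactly if the simulated user holds one. -/
def CoalitionAdversary.asSP (P : Params p G₁ G₂ GT) (𝒜 : CoalitionAdversary p G₁ G₂ GT D) :
    SPAdversary p G₁ G₂ D where
  State := SimState p G₁ G₂ 𝒜.State
  init := do
    let (st, pk, xS) ← 𝒜.init
    let xU₀ ← unif p
    let xU₁ ← unif p
    pure (⟨st, pk, fun i => User.fresh (if i then xU₁ else xU₀) (xS i), false⟩,
      ⟨P.h, P.g, P.g, P.g, P.g_ne, P.g_ne, P.g_ne⟩)
  sp :=
    { openIssue := fun w d a _ => do
        let w₁ ← 𝒜.simRun P d (.issue a) w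
        pure (w₁, some fun _ => false)
      issue := fun w a U _ _ =>
        pure (w, ((w.users (!w.cur)).creds a).map fun _ => (P.g + U + a • P.g, 0, 0))
      openShow := fun w d ctx => do
        let w₁ ← 𝒜.simRun P d (.present ctx.a) w
        pure (w₁, none)
      verify := fun w _ _ _ => pure (w, false) }
  driver :=
    { queryBound := 𝒜.driver.queryBound
      next := fun w => do
        let (st, query) ← 𝒜.driver.next w.st
        pure ({ w with st := st, cur := (query.map Prod.fst).getD false }, query)
      challenge := fun w => do
        let (st, aux) ← 𝒜.driver.challenge w.st
        pure ({ w with st := st, cur := false }, aux)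
      guess := fun w => 𝒜.driver.guess w.st }

end Simulation

end

end ThresholdBBS

namespace ThresholdBBS

noncomputable section

/-! ### Probability mass functions -/

section PMFLemmas

variable {α β γ : Type}

/-! Privacy is perfect. All parties other than the running user share one state `W`. For arbitrary
strategies of TS and SP, the law of this state after a run is the same for every user who can run
the protocol on the given input and holds valid credentials only, provided that the identification
data have the same law (`map_fst_runTCP_eq`). The randomized share sent to the TS is uniform, and
the blinding exponents make `U`, respectively `C₁` and `C₂`, uniform up to the factor contributed by
the TS. After that the secrets enter only as the witness of a Sigma protocol, and any two witnesses
of one statement give the same transcripts (`bind_transcript`). This survives a malicious TS that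
influences the challenge: its reply depends on the witness and the prover's randomness only through
the commitment.

An honest SP ignores the identification data. Both orders of the challenge are then the same kernel
applied twice, and the guess is independent of the bit. Showing needs valid credentials, an
invariant because users check what they store (`queryPhase_sound`).

With a colluding SP only the identification data can separate the users, and an SP alone receives
those as well. It can therefore play two users of its own towards the coalition, attaching the real
identification data. In the queries, real and simulated users hold credentials for the same
attributes (`SameHoldings`). In the challenge the simulated user may differ from the real one, which
by the first paragraph changes nothing. The two games have equal output distributions
(`CoalitionAdversary.game_asSP`), which is more than the claimed inequality. -/

theorem bind_congr_support (q : PMF α) {f f' : α → PMF β} (h : ∀ a ∈ q.support, f a = f' a) :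
    q >>= f = q >>= f' := by
  change q.bind f = q.bind f'
  ext b
  simp only [PMF.bind_apply]
  refine tsum_congr fun a => ?_
  by_cases ha : q a = 0
  · simp [ha]
  · rw [h a ((PMF.mem_support_iff _ _).2 ha)]

theorem bind_swap (q : PMF α) (r : PMF β) (f : α → β → PMF γ) :
    (q >>= fun a => r >>= fun b => f a b) = r >>= fun b => q >>= fun a => f a b :=
  PMF.bind_comm q r f

theorem bind_const' (q : PMF α) (r : PMF β) : (q >>= fun _ => r) = r := PMF.bind_const q r

theorem mem_support_monadBind {q : PMF α} {f : α → PMF β} {b : β} :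
    b ∈ (q >>= f).support ↔ ∃ a ∈ q.support, b ∈ (f a).support :=
  PMF.mem_support_bind_iff q f b

theorem mem_support_monadPure {a b : α} : b ∈ (pure a : PMF α).support ↔ b = a :=
  PMF.mem_support_pure_iff a b

theorem pmfMap_eq_bind (f : α → β) (q : PMF α) : PMF.map f q = q >>= fun a => pure (f a) := rfl

theorem uniform_bind_equiv [Fintype α] [Nonempty α] (σ : α ≃ α) (f : α → PMF β) :
    (PMF.uniformOfFintype α >>= fun a => f (σ a)) = PMF.uniformOfFintype α >>= f := by
  change PMF.bind _ _ = PMF.bind _ _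
  ext b
  simp only [PMF.bind_apply, PMF.uniformOfFintype_apply]
  exact σ.tsum_eq fun a => (Fintype.card α : ENNReal)⁻¹ * f a b

theorem uniform_prod_bind [Fintype α] [Nonempty α] [Fintype β] [Nonempty β]
    (f : α × β → PMF γ) :
    PMF.uniformOfFintype (α × β) >>= f =
      PMF.uniformOfFintype α >>= fun a => PMF.uniformOfFintype β >>= fun b => f (a, b) := by
  change PMF.bind _ _ = PMF.bind _ fun a => PMF.bind _ fun b => _
  ext c
  simp only [PMF.bind_apply, PMF.uniformOfFintype_apply, ENNReal.tsum_prod', Fintype.card_prod,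
    Nat.cast_mul]
  refine tsum_congr fun a => ?_
  rw [← ENNReal.tsum_mul_left]
  refine tsum_congr fun b => ?_
  rw [ENNReal.mul_inv (.inr (ENNReal.natCast_ne_top _)) (.inl (ENNReal.natCast_ne_top _)),
    mul_assoc]

/-- Honest-prover view of a Sigma protocol against an arbitrary challenge: if the commitment `L k`
does not distinguish the witnesses `v` and `v'`, then neither does the transcript, however the
challenge depends on the commitment. -/
theorem bind_transcript {R K E : Type} [Ring R] [AddCommGroup K] [Module R K] [Fintype K]
    (L : K → E) (T : E → PMF α) (c : E → α → R) (G : E → α → K → PMF β) (v v' : K)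
    (hL : ∀ k (t : R), L (k + t • (v - v')) = L k) :
    (PMF.uniformOfFintype K >>= fun k => T (L k) >>= fun r => G (L k) r (k + c (L k) r • v)) =
      PMF.uniformOfFintype K >>= fun k => T (L k) >>= fun r =>
        G (L k) r (k + c (L k) r • v') := by
  change (PMF.bind _ fun k => PMF.bind _ fun r => _) = PMF.bind _ fun k => PMF.bind _ fun r => _
  ext b
  simp only [PMF.bind_apply, PMF.uniformOfFintype_apply, ENNReal.tsum_mul_left]
  congr 1
  -- Sum over the reply first: once `r` is fixed, the challenge depends on `k` only through `L k`,
  -- so the substitution below is a bijection.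
  rw [ENNReal.tsum_comm]
  conv_rhs => rw [ENNReal.tsum_comm]
  refine tsum_congr fun r => ?_
  let σ : K ≃ K :=
    { toFun := fun k => k + c (L k) r • (v - v')
      invFun := fun k => k + (-c (L k) r) • (v - v')
      left_inv := fun k => by simp [hL]
      right_inv := fun k => by
        have := hL k (-c (L k) r)
        simp only [this]
        simp }
  conv_rhs => rw [← σ.tsum_eq]
  refine tsum_congr fun k => ?_
  have h1 : L (σ k) = L k := hL k _
  have h2 : σ k + c (L k) r • v' = k + c (L k) r • v := by
    change k + c (L k) r • (v - v') + c (L k) r • v' = _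
    rw [smul_sub]; abel
  rw [h1, h2]

end PMFLemmas

section Reindex

variable {p : ℕ} [Fact p.Prime] {β : Type}

theorem unif_bind_shift (t : ZMod p) (f : ZMod p → PMF β) :
    (unif p >>= fun a => f (a + t)) = unif p >>= f :=
  uniform_bind_equiv (Equiv.addRight t) f

end Reindex

/-! ### Groups of prime order -/

theorem exists_smul_eq_of_card {p : ℕ} [Fact p.Prime] {M : Type} [AddCommGroup M]
    [Module (ZMod p) M] (hM : Nat.card M = p) {x : M} (hx : x ≠ 0) (y : M) :
    ∃ c : ZMod p, c • x = y := by
  have : Finite M := Nat.finite_of_card_ne_zero (hM ▸ (Fact.out : p.Prime).ne_zero)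
  have hinj : Function.Injective fun c : ZMod p => c • x := smul_left_injective _ hx
  have := Fintype.ofFinite M
  have hb := (Fintype.bijective_iff_injective_and_card (fun c : ZMod p => c • x)).2
    ⟨hinj, by rw [ZMod.card, ← Nat.card_eq_fintype_card, hM]⟩
  exact hb.2 y

/-! ### A run does not depend on the secrets of the user -/

section RunView

variable {p : ℕ} [Fact p.Prime] {G₁ G₂ GT D W : Type}
  [AddCommGroup G₁] [Module (ZMod p) G₁] [AddCommGroup G₂] [Module (ZMod p) G₂]
  [AddCommGroup GT] [Module (ZMod p) GT]

/-- The view of the other parties in an issuance from the moment on at which the user has fixed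
`U`; she uses `(x, s)` as her witness. -/
def issueTail (P : Params p G₁ G₂ GT) (pk : PublicKey G₁ G₂)
    (ts : TSRole p G₁ G₂ GT W) (sp : SPRole p G₁ G₂ D W) (ident : PMF D)
    (a : ZMod p) (w₂ : W) (U : G₁) (x s : ZMod p) : PMF W := do
  let d ← ident
  let r ← sp.openIssue w₂ d a U
  match r.2 with
  | none => pure r.1
  | some nonce =>
    let tU ← unif p
    let k ← unif p
    let r' ← ts.issue r.1 ⟨pk.B₀, ⟨U, pk.B, pk.B₀⟩, nonce, k • pk.B + tU • pk.B₀⟩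
    match r'.2 with
    | none => pure r'.1
    | some (Utilde, rS) =>
      let c := P.H (.issuance Utilde ⟨U, pk.B, pk.B₀⟩ nonce)
      let r'' ← sp.issue r'.1 a U nonce ⟨c, k + c * s, tU + c * x + rS⟩
      pure r''.1

/-- The view of the other parties in a showing from the moment on at which the user has fixed
the statement; she uses `v` as her witness. -/
def showTail (P : Params p G₁ G₂ GT) (pk : PublicKey G₁ G₂)
    (ts : TSRole p G₁ G₂ GT W) (sp : SPRole p G₁ G₂ D W) (ident : PMF D)
    (a : ZMod p) (w₁ : W) (C₁ C₂ : G₁) (v : ShowProof p) : PMF W := do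
  let d ← ident
  let r ← sp.openShow w₁ d ⟨pk, C₁, C₂, a⟩
  match r.2 with
  | none => pure r.1
  | some nonce =>
    let kr₁ ← unif p
    let kr₂ ← unif p
    let kα₁ ← unif p
    let kα₂ ← unif p
    let ke ← unif p
    let kx ← unif p
    let ks ← unif p
    let E₁ := kr₁ • P.g₁ + kr₂ • P.g₂
    let E₂ := kα₁ • P.g₁ + kα₂ • P.g₂ - ke • C₂
    let E₃p := ks • P.pair pk.B P.h + kx • P.pair pk.B₀ P.h + kr₁ • P.pair P.g₂ pk.w
      + kα₁ • P.pair P.g₂ P.h - ke • P.pair C₁ P.h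
    let r' ← ts.present r.1 ⟨P.pair pk.B₀ P.h, ⟨pk, C₁, C₂, a⟩, nonce, E₁, E₂, E₃p⟩
    match r'.2 with
    | none => pure r'.1
    | some (E₃, rS) =>
      let c := P.H (.showing E₁ E₂ E₃ ⟨pk, C₁, C₂, a⟩ nonce)
      let r'' ← sp.verify r'.1 ⟨pk, C₁, C₂, a⟩ nonce
        ⟨c, kr₁ + c * v.zr₁, kr₂ + c * v.zr₂, kα₁ + c * v.zα₁, kα₂ + c * v.zα₂, ke + c * v.ze,
          kx + c * v.zx + rS, ks + c * v.zs⟩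
      pure r''.1

/-! ### Views of a single run: witness indistinguishability and blinding. -/

variable (P : Params p G₁ G₂ GT) (pk : PublicKey G₁ G₂)
    (ts : TSRole p G₁ G₂ GT W) (sp : SPRole p G₁ G₂ D W) (ident : PMF D)

/-- Nobody else learns whether the user accepts the credential, so her validity check disappears
once her final state is forgotten. -/
theorem map_fst_runIssue (u : User p G₁) (a : ZMod p) (w₀ : W) :
    Prod.fst <$> runIssue P pk ts sp ident u a w₀ = (do
      let μ ← unif p
      let w₁ ← ts.start w₀ (u.xS + μ) .issuance
      let r ← ts.base w₁ pk.B₀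
      match r.2 with
      | none => pure r.1
      | some V =>
        let s₁ ← unif p
        issueTail P pk ts sp ident a r.1 (s₁ • pk.B + (u.xU - μ) • pk.B₀ + V) (u.xU - μ) s₁) := by
  simp only [runIssue, issueTail, map_bind]
  refine bind_congr fun μ => bind_congr fun w₁ => bind_congr fun r => ?_
  rcases r with ⟨w₂, _ | V⟩
  · exact map_pure _ _
  simp only [map_bind]
  refine bind_congr fun s₁ => bind_congr fun d => bind_congr fun r => ?_
  rcases r with ⟨w₃, _ | nonce⟩
  · exact map_pure _ _
  simp only [map_bind]
  refine bind_congr fun tU => bind_congr fun k => bind_congr fun r => ?_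
  rcases r with ⟨w₄, _ | ⟨Ut, rS⟩⟩
  · exact map_pure _ _
  simp only [map_bind]
  refine bind_congr fun r => ?_
  rcases r with ⟨w₅, _ | ⟨A, e, s₂⟩⟩
  · exact map_pure _ _
  dsimp only
  split_ifs <;> exact map_pure _ _

theorem runShow_eq (u : User p G₁) (a : ZMod p) (cred : Credential p G₁) (w₀ : W) :
    runShow P pk ts sp ident u a cred w₀ = (do
      let μ ← unif p
      let w₁ ← ts.start w₀ (u.xS + μ) .showing
      let r₁ ← unif p
      let r₂ ← unif p
      showTail P pk ts sp ident a w₁ (cred.A + r₁ • P.g₂) (r₁ • P.g₁ + r₂ • P.g₂)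
        ⟨0, r₁, r₂, cred.e * r₁, cred.e * r₂, cred.e, u.xU - μ, cred.s⟩) := by
  unfold runShow showTail
  refine bind_congr fun μ => bind_congr fun w₁ => bind_congr fun r₁ => bind_congr fun r₂ =>
    bind_congr fun d => bind_congr fun r => ?_
  rcases r with ⟨w₃, _ | nonce⟩
  · rfl
  refine bind_congr fun _ => bind_congr fun _ => bind_congr fun _ => bind_congr fun _ =>
    bind_congr fun _ => bind_congr fun _ => bind_congr fun _ => bind_congr fun r => ?_
  rcases r with ⟨w₄, _ | ⟨E₃, rS⟩⟩
  · rfl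
  rfl

/-- Perfect witness indistinguishability of the issuance proof: the hypothesis says that both pairs
represent the same element, hence the commitment map vanishes on their difference. -/
theorem issueTail_congr (a : ZMod p) (w : W) (U : G₁) {x s x' s' : ZMod p}
    (h : s • pk.B + x • pk.B₀ = s' • pk.B + x' • pk.B₀) :
    issueTail P pk ts sp ident a w U x s = issueTail P pk ts sp ident a w U x' s' := by
  simp only [issueTail]
  refine bind_congr fun d => bind_congr fun r => ?_
  rcases r with ⟨w₃, _ | nonce⟩
  · rfl
  have key := bind_transcript (R := ZMod p) (K := ZMod p × ZMod p)
    (L := fun k => k.2 • pk.B + k.1 • pk.B₀)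
    (T := fun E => ts.issue w₃ ⟨pk.B₀, ⟨U, pk.B, pk.B₀⟩, nonce, E⟩)
    (c := fun _ r => match r.2 with
      -- If the TS refuses, no response is sent, so any challenge would do here.
      | none => 0
      | some y => P.H (.issuance y.1 ⟨U, pk.B, pk.B₀⟩ nonce))
    (G := fun _ r z => match r.2 with
      | none => (pure r.1 : PMF W)
      | some y => sp.issue r.1 a U nonce
          ⟨P.H (.issuance y.1 ⟨U, pk.B, pk.B₀⟩ nonce), z.2, z.1 + y.2⟩ >>= fun q => pure q.1)
    (x, s) (x', s') (by
      intro k t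
      have h0 : (s - s') • pk.B + (x - x') • pk.B₀ = 0 := by
        rw [sub_smul, sub_smul, sub_add_sub_comm, h, sub_self]
      simp only [Prod.snd_add, Prod.fst_add, Prod.smul_snd, Prod.smul_fst, Prod.snd_sub,
        Prod.fst_sub, smul_eq_mul]
      calc _ = k.2 • pk.B + k.1 • pk.B₀ + t • ((s - s') • pk.B + (x - x') • pk.B₀) := by module
        _ = _ := by rw [h0, smul_zero, add_zero])
  simp only [uniform_prod_bind] at key
  refine Eq.trans ?_ (key.trans ?_)
  all_goals
    refine bind_congr fun tU => bind_congr fun k => bind_congr fun r => ?_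
    rcases r with ⟨w₄, _ | ⟨Ut, rS⟩⟩ <;> rfl

/-- The analogue for showing: the three hypotheses say that the linear maps defining `E₁`, `E₂` and
the partial `E₃` agree on the two witnesses. The field `c` of `ShowProof` plays no role in a
witness. -/
theorem showTail_congr (a : ZMod p) (w : W) (C₁ C₂ : G₁) {v v' : ShowProof p}
    (h₁ : v.zr₁ • P.g₁ + v.zr₂ • P.g₂ = v'.zr₁ • P.g₁ + v'.zr₂ • P.g₂)
    (h₂ : v.zα₁ • P.g₁ + v.zα₂ • P.g₂ - v.ze • C₂ = v'.zα₁ • P.g₁ + v'.zα₂ • P.g₂ - v'.ze • C₂)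
    (h₃ : v.zs • P.pair pk.B P.h + v.zx • P.pair pk.B₀ P.h + v.zr₁ • P.pair P.g₂ pk.w
        + v.zα₁ • P.pair P.g₂ P.h - v.ze • P.pair C₁ P.h =
      v'.zs • P.pair pk.B P.h + v'.zx • P.pair pk.B₀ P.h + v'.zr₁ • P.pair P.g₂ pk.w
        + v'.zα₁ • P.pair P.g₂ P.h - v'.ze • P.pair C₁ P.h) :
    showTail P pk ts sp ident a w C₁ C₂ v = showTail P pk ts sp ident a w C₁ C₂ v' := by
  simp only [showTail]
  refine bind_congr fun d => bind_congr fun r => ?_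
  rcases r with ⟨w₃, _ | nonce⟩
  · rfl
  rcases v with ⟨c, r₁, r₂, α₁, α₂, e, x, s⟩
  rcases v' with ⟨c', r₁', r₂', α₁', α₂', e', x', s'⟩
  dsimp only at h₁ h₂ h₃ ⊢
  have key := bind_transcript (R := ZMod p)
    (K := ZMod p × ZMod p × ZMod p × ZMod p × ZMod p × ZMod p × ZMod p)
    (E := G₁ × G₁ × GT)
    (L := fun k => (k.1 • P.g₁ + k.2.1 • P.g₂,
      k.2.2.1 • P.g₁ + k.2.2.2.1 • P.g₂ - k.2.2.2.2.1 • C₂,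
      k.2.2.2.2.2.2 • P.pair pk.B P.h + k.2.2.2.2.2.1 • P.pair pk.B₀ P.h
        + k.1 • P.pair P.g₂ pk.w + k.2.2.1 • P.pair P.g₂ P.h
        - k.2.2.2.2.1 • P.pair C₁ P.h))
    (T := fun E => ts.present w₃
      ⟨P.pair pk.B₀ P.h, ⟨pk, C₁, C₂, a⟩, nonce, E.1, E.2.1, E.2.2⟩)
    (c := fun E r => match r.2 with
      | none => 0
      | some y => P.H (.showing E.1 E.2.1 y.1 ⟨pk, C₁, C₂, a⟩ nonce))
    (G := fun E r z => match r.2 with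
      | none => (pure r.1 : PMF W)
      | some y => sp.verify r.1 ⟨pk, C₁, C₂, a⟩ nonce
          ⟨P.H (.showing E.1 E.2.1 y.1 ⟨pk, C₁, C₂, a⟩ nonce), z.1, z.2.1, z.2.2.1, z.2.2.2.1,
            z.2.2.2.2.1, z.2.2.2.2.2.1 + y.2, z.2.2.2.2.2.2⟩ >>= fun q => pure q.1)
    (r₁, r₂, α₁, α₂, e, x, s) (r₁', r₂', α₁', α₂', e', x', s') (by
      rintro ⟨k₁, k₂, k₃, k₄, k₅, k₆, k₇⟩ t
      rw [← sub_eq_zero] at h₁ h₂ h₃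
      simp only [Prod.mk_sub_mk, Prod.smul_mk, Prod.mk_add_mk, smul_eq_mul]
      refine Prod.ext ?_ (Prod.ext ?_ ?_)
      · rw [← sub_eq_zero, ← smul_zero t, ← h₁]
        module
      · rw [← sub_eq_zero, ← smul_zero t, ← h₂]
        module
      · rw [← sub_eq_zero, ← smul_zero t, ← h₃]
        module)
  simp only [uniform_prod_bind] at key
  refine Eq.trans ?_ (key.trans ?_)
  all_goals
    refine bind_congr fun _ => bind_congr fun _ => bind_congr fun _ => bind_congr fun _ =>
      bind_congr fun _ => bind_congr fun _ => bind_congr fun _ => bind_congr fun r => ?_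
    rcases r with ⟨w₄, _ | ⟨Ut, rS⟩⟩ <;> rfl

/-- Every issuance is brought to a normal form free of the user's secrets: a uniform share `y` for
the TS, a uniform multiple of `B` in `U`, and the witness whose `B₀`-exponent is `0`. -/
theorem map_fst_runIssue_eq (u u' : User p G₁) (a : ZMod p) (w : W) :
    Prod.fst <$> runIssue P pk ts sp ident u a w =
      Prod.fst <$> runIssue P pk ts sp ident u' a w := by
  suffices h : ∀ u : User p G₁, Prod.fst <$> runIssue P pk ts sp ident u a w = (do
      let y ← unif p
      let w₁ ← ts.start w y .issuance
      let r ← ts.base w₁ pk.B₀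
      match r.2 with
      | none => pure r.1
      | some V =>
        let s ← unif p
        issueTail P pk ts sp ident a r.1 (s • pk.B + V) 0 s) by rw [h, h]
  intro u
  obtain ⟨β, hβ⟩ := exists_smul_eq_of_card P.card_G₁ pk.B_ne pk.B₀
  rw [map_fst_runIssue]
  refine Eq.trans ?_ (unif_bind_shift u.xS _)
  refine bind_congr fun μ => ?_
  rw [add_comm u.xS μ]
  refine bind_congr fun w₁ => bind_congr fun r => ?_
  rcases r with ⟨w₂, _ | V⟩
  · rfl
  dsimp only
  -- As `B₀` is `β • B`, the user's share of the key is absorbed into the uniform exponent of `B`.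
  refine Eq.trans ?_ (unif_bind_shift ((u.xU - μ) * β) _)
  refine bind_congr fun s => ?_
  have h : (s + (u.xU - μ) * β) • pk.B = s • pk.B + (u.xU - μ) • pk.B₀ := by
    rw [add_smul, mul_smul, hβ]
  rw [h]
  exact issueTail_congr _ _ _ _ _ _ _ _ (by rw [h, zero_smul, add_zero])

/-- Again a normal form: `C₁` and `C₂` are uniform multiples of `g₂`, and the witness has `e = s =
r₁ = 0`. Such a witness exists for every statement because the pairing of `B₀` and `h` generates the
target group; `ζ` is the discrete logarithm to that base. -/
theorem runShow_eq_of_valid {u u' : User p G₁} {a : ZMod p} {cred cred' : Credential p G₁}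
    (h : ValidCred P pk (u.xU + u.xS) a cred) (h' : ValidCred P pk (u'.xU + u'.xS) a cred')
    (w : W) :
    runShow P pk ts sp ident u a cred w = runShow P pk ts sp ident u' a cred' w := by
  obtain ⟨γ, hγ⟩ := exists_smul_eq_of_card P.card_G₁ P.g₂_ne P.g₁
  have hne : P.pair pk.B₀ P.h ≠ 0 := by
    obtain ⟨δ, hδ⟩ := exists_smul_eq_of_card P.card_G₁ pk.B₀_ne P.g
    intro h0
    exact P.pair_ne (by rw [← hδ, map_smul, LinearMap.smul_apply, h0, smul_zero])
  choose ζ hζ using exists_smul_eq_of_card P.card_GT hne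
  suffices key : ∀ (u : User p G₁) (cred : Credential p G₁),
      ValidCred P pk (u.xU + u.xS) a cred → runShow P pk ts sp ident u a cred w = (do
      let y ← unif p
      let w₁ ← ts.start w y .showing
      let r₁ ← unif p
      let r₂ ← unif p
      showTail P pk ts sp ident a w₁ (r₁ • P.g₂) (r₂ • P.g₂)
        -- The key exponent solves the pairing equation of the statement, less the part `y` for
        -- which the TS is responsible. The leading `0` fills the unused challenge field.
        ⟨0, 0, r₂, 0, 0, 0, ζ (P.pair (r₁ • P.g₂) pk.w - P.pair P.g P.h - a • P.pair pk.B₁ P.h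
          - y • P.pair pk.B₀ P.h), 0⟩) by rw [key u cred h, key u' cred' h']
  clear h h'
  intro u cred h
  obtain ⟨α, hα⟩ := exists_smul_eq_of_card P.card_G₁ P.g₂_ne cred.A
  rw [runShow_eq]
  refine Eq.trans ?_ (unif_bind_shift u.xS _)
  refine bind_congr fun μ => ?_
  rw [add_comm u.xS μ]
  refine bind_congr fun w₁ => ?_
  -- The shift by the logarithm of `A` hides the credential in `C₁`; the next one absorbs the
  -- `g₁`-part of `C₂`.
  refine Eq.trans ?_ (unif_bind_shift α _)
  refine bind_congr fun r₁ => ?_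
  refine Eq.trans ?_ (unif_bind_shift (r₁ * γ) _)
  refine bind_congr fun r₂ => ?_
  have h₁ : (r₁ + α) • P.g₂ = cred.A + r₁ • P.g₂ := by rw [add_smul, hα, add_comm]
  have h₂ : (r₂ + r₁ * γ) • P.g₂ = r₁ • P.g₁ + r₂ • P.g₂ := by
    rw [add_smul, mul_smul, hγ, add_comm]
  rw [h₁, h₂]
  refine showTail_congr _ _ _ _ _ _ _ _ _ ?_ ?_ ?_
  · dsimp only
    rw [h₂, zero_smul, zero_add]
  · dsimp only
    module
  · dsimp only
    rw [hζ]
    simp only [ValidCred, map_add, map_smul, LinearMap.add_apply, LinearMap.smul_apply] at h ⊢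
    -- Validity of the credential, solved for the only term that the user's witness does not express
    -- in the bases of the proof.
    have h' : P.pair cred.A pk.w = P.pair P.g P.h + cred.s • P.pair pk.B P.h
      + (u.xU + u.xS) • P.pair pk.B₀ P.h + a • P.pair pk.B₁ P.h - cred.e • P.pair cred.A P.h :=
      eq_sub_of_add_eq' h
    rw [h']
    module

/-- `u` holds valid credentials only. -/
def User.Sound (u : User p G₁) : Prop :=
  ∀ a cred, u.creds a = some cred → ValidCred P pk (u.xU + u.xS) a cred

theorem map_fst_runTCP_eq {u u' : User p G₁} (h : u.Sound P pk) (h' : u'.Sound P pk)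
    {aux : Aux p} (hu : u.CanRun aux) (hu' : u'.CanRun aux) (w : W) :
    Prod.fst <$> runTCP P pk ts sp ident u aux w =
      Prod.fst <$> runTCP P pk ts sp ident u' aux w := by
  rcases aux with a | a
  · exact map_fst_runIssue_eq _ _ _ _ _ _ _ _ _
  · obtain ⟨cred, hc⟩ := Option.ne_none_iff_exists'.1 hu
    obtain ⟨cred', hc'⟩ := Option.ne_none_iff_exists'.1 hu'
    simp only [runTCP, hc, hc', map_bind, map_pure]
    rw [runShow_eq_of_valid P pk ts sp ident (h a cred hc) (h' a cred' hc')]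

end RunView

theorem forall_update {ι α : Type} [DecidableEq ι] {f : ι → α} {q : ι → α → Prop}
    (hf : ∀ i, q i (f i)) {i : ι} {x : α} (hx : q i x) (j : ι) : q j (Function.update f i x j) := by
  by_cases h : j = i
  · subst h
    rwa [Function.update_self]
  · rw [Function.update_of_ne h]
    exact hf j

/-- The user after she stored a credential for the attribute `a`. -/
def User.store {p : ℕ} {G₁ : Type} (u : User p G₁) (a : ZMod p) (cred : Credential p G₁) : User p G₁ :=
  { u with creds := Function.update u.creds a (some cred) }

section Soundness

variable {p : ℕ} [Fact p.Prime] {G₁ G₂ GT D W : Type}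
  [AddCommGroup G₁] [Module (ZMod p) G₁] [AddCommGroup G₂] [Module (ZMod p) G₂]
  [AddCommGroup GT] [Module (ZMod p) GT]
  (P : Params p G₁ G₂ GT) (pk : PublicKey G₁ G₂)
  (ts : TSRole p G₁ G₂ GT W) (sp : SPRole p G₁ G₂ D W)

/-! ### Users hold valid credentials only -/

theorem User.sound_fresh (xU xS : ZMod p) : (User.fresh xU xS : User p G₁).Sound P pk :=
  fun _ _ h => nomatch h

variable {P pk} in
theorem User.Sound.store {u : User p G₁} (h : u.Sound P pk) {a : ZMod p}
    {cred : Credential p G₁} (hc : ValidCred P pk (u.xU + u.xS) a cred) :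
    (u.store a cred).Sound P pk := by
  intro a' cred' h'
  by_cases ha : a' = a
  · subst ha
    have : cred = cred' := by simpa [User.store] using h'
    exact this ▸ hc
  · exact h a' cred' (by simpa [User.store, ha] using h')

theorem runIssue_support (ident : PMF D) (u : User p G₁) (a : ZMod p) (w : W) :
    ∀ r ∈ (runIssue P pk ts sp ident u a w).support,
      r.2 = u ∨ ∃ cred, ValidCred P pk (u.xU + u.xS) a cred ∧ r.2 = u.store a cred := by
  intro r hr
  simp only [runIssue, mem_support_monadBind] at hr
  obtain ⟨μ, -, w₁, -, ⟨w₂, _ | V⟩, -, hr⟩ := hr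
  · exact .inl (by rw [mem_support_monadPure.1 hr])
  simp only [mem_support_monadBind] at hr
  obtain ⟨s₁, -, d, -, ⟨w₃, _ | nonce⟩, -, hr⟩ := hr
  · exact .inl (by rw [mem_support_monadPure.1 hr])
  simp only [mem_support_monadBind] at hr
  obtain ⟨tU, -, k, -, ⟨w₄, _ | ⟨Ut, rS⟩⟩, -, hr⟩ := hr
  · exact .inl (by rw [mem_support_monadPure.1 hr])
  simp only [mem_support_monadBind] at hr
  obtain ⟨⟨w₅, _ | ⟨A, e, s₂⟩⟩, -, hr⟩ := hr
  · exact .inl (by rw [mem_support_monadPure.1 hr])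
  dsimp only at hr
  split_ifs at hr with hv
  · exact .inr ⟨_, hv, by rw [mem_support_monadPure.1 hr]; rfl⟩
  · exact .inl (by rw [mem_support_monadPure.1 hr])

theorem runTCP_sound (ident : PMF D) {u : User p G₁} (hu : u.Sound P pk) (aux : Aux p) (w : W) :
    ∀ r ∈ (runTCP P pk ts sp ident u aux w).support, r.2.Sound P pk := by
  intro r hr
  rcases aux with a | a
  · rcases runIssue_support P pk ts sp ident u a w r hr with h | ⟨cred, hc, h⟩
    · rwa [h]
    · rw [h]; exact hu.store hc
  · simp only [runTCP] at hr
    rcases hc : u.creds a with _ | cred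
    · simp only [hc] at hr
      rwa [mem_support_monadPure.1 hr]
    · simp only [hc, mem_support_monadBind] at hr
      obtain ⟨w₁, -, hr⟩ := hr
      rwa [mem_support_monadPure.1 hr]

theorem queryPhase_sound (drv : Driver p W) (ident : Bool → Aux p → PMF D) (n : ℕ) (w : W)
    (us : Bool → User p G₁) (hus : ∀ i, (us i).Sound P pk) :
    ∀ r ∈ (queryPhase P pk ts sp drv ident n w us).support, ∀ i, (r.2 i).Sound P pk := by
  induction n generalizing w us with
  | zero =>
    intro r hr
    rw [mem_support_monadPure.1 hr]
    exact hus
  | succ n ih =>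
    intro r hr
    simp only [queryPhase, mem_support_monadBind] at hr
    obtain ⟨⟨w₁, _ | ⟨i, aux⟩⟩, -, hr⟩ := hr
    · rw [mem_support_monadPure.1 hr]
      exact hus
    · obtain ⟨⟨w₂, u⟩, hu, hr⟩ := mem_support_monadBind.1 hr
      exact ih w₂ _ (forall_update (q := fun _ => User.Sound P pk) hus
        (runTCP_sound P pk ts sp _ (hus i) aux w₁ _ hu)) r hr

end Soundness

/-! ### Privacy against an honest SP -/

theorem bind_apply_le {α : Type} (q : PMF α) (f : α → PMF Bool) (c : ENNReal)
    (h : ∀ a ∈ q.support, f a true ≤ c) : (q >>= f) true ≤ c := by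
  change (q.bind f) true ≤ c
  rw [PMF.bind_apply]
  calc ∑' a, q a * f a true ≤ ∑' a, q a * c := ENNReal.tsum_le_tsum fun a => by
        by_cases ha : q a = 0
        · simp [ha]
        · exact mul_le_mul_right (h a ((PMF.mem_support_iff _ _).2 ha)) _
    _ = c := by rw [ENNReal.tsum_mul_right, q.tsum_coe, one_mul]

/-- Condition on the guess, which is drawn independently of the bit. -/
theorem guess_uniform_bit (q : PMF Bool) :
    (PMF.uniformOfFintype Bool >>= fun b => q >>= fun g => pure (g == b)) true ≤ 1 / 2 := by
  rw [bind_swap]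
  refine bind_apply_le _ _ _ fun g _ => ?_
  change (PMF.bind _ fun b => PMF.pure (g == b)) true ≤ _
  rw [PMF.bind_apply, tsum_bool]
  cases g <;> simp [PMF.pure_apply]

section HonestSP

variable {p : ℕ} [Fact p.Prime] {G₁ G₂ GT D W : Type}
  [AddCommGroup G₁] [Module (ZMod p) G₁] [AddCommGroup G₂] [Module (ZMod p) G₂]
  [AddCommGroup GT] [Module (ZMod p) GT]
  (P : Params p G₁ G₂ GT)

theorem runTCP_honestSP_ident (ik : IssuerKey p G₁) (ts : TSRole p G₁ G₂ GT W)
    (ident ident' : PMF D) (u : User p G₁) (aux : Aux p) (w : W) :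
    runTCP P (ik.pk P) ts (honestSP P ik D W) ident u aux w =
      runTCP P (ik.pk P) ts (honestSP P ik D W) ident' u aux w := by
  rcases aux with a | a <;>
    simp only [runTCP, runIssue, runShow, honestSP, bind_const']

/-- By `hsp` the identification data are irrelevant, so each challenge run acts on the state by one
kernel `R`, whoever performs it. The guess is made after `R` twice, for either value of `b`. -/
theorem privacyGame_le_half (pk : PublicKey G₁ G₂) (ts : TSRole p G₁ G₂ GT W)
    (sp : SPRole p G₁ G₂ D W)
    (drv : Driver p W) (ident : Bool → Aux p → PMF D) (w : W) (us : Bool → User p G₁)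
    (hus : ∀ i, (us i).Sound P pk)
    (hsp : ∀ (ident ident' : PMF D) (u : User p G₁) (aux : Aux p) (w : W),
      runTCP P pk ts sp ident u aux w = runTCP P pk ts sp ident' u aux w) :
    privacyGame P pk ts sp drv ident w us true ≤ 1 / 2 := by
  unfold privacyGame
  refine bind_apply_le _ _ _ fun ⟨w₁, us⟩ h => bind_apply_le _ _ _ fun ⟨w₂, aux⟩ _ => ?_
  have hs := queryPhase_sound P pk ts sp drv ident _ w _ hus _ h
  dsimp only at hs ⊢
  split_ifs with hr
  · let R : W → PMF W := fun w => Prod.fst <$> runTCP P pk ts sp (ident false aux) (us false) aux w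
    have hR : ∀ b w, Prod.fst <$> runTCP P pk ts sp (ident b aux) (us b) aux w = R w := by
      intro b w
      rw [hsp _ (ident false aux)]
      exact map_fst_runTCP_eq _ _ _ _ _ (hs b) (hs false)
        (by cases b; exacts [hr.1, hr.2]) hr.1 w
    refine le_of_eq_of_le ?_ (guess_uniform_bit (R w₂ >>= fun w₃ => R w₃ >>= drv.guess))
    congr 1
    refine bind_congr fun b => ?_
    simp only [← hR b w₂, ← hR (!b), bind_map_left, bind_assoc]
  · change (PMF.pure false) true ≤ _
    simp [PMF.pure_apply]

theorem HonestSPAdversary.winProb_le_half (ident : Bool → Aux p → PMF D) (ik : IssuerKey p G₁)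
    (𝒜 : HonestSPAdversary p G₁ G₂ GT) : 𝒜.winProb P ident ik ≤ 1 / 2 := by
  have h : 𝒜.game P ident ik true ≤ 1 / 2 := by
    unfold HonestSPAdversary.game
    refine bind_apply_le _ _ _ fun _ _ => bind_apply_le _ _ _ fun _ _ =>
      bind_apply_le _ _ _ fun _ _ => ?_
    exact privacyGame_le_half P _ _ _ _ _ _ _ (fun i => User.sound_fresh P _ _ _)
      (runTCP_honestSP_ident P ik _)
  have := ENNReal.toReal_mono (by simp) h
  simpa [HonestSPAdversary.winProb] using this

end HonestSP

/-- Two users hold credentials for the same attributes. -/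
def SameHoldings {p : ℕ} {G₁ : Type} (u u' : User p G₁) : Prop := ∀ a, u.creds a = none ↔ u'.creds a = none

/-- The real user gets a credential exactly if the simulated one holds one after her run. That may
be an old one kept through a failed run; the real user then held one too, so overwriting it changes
no holdings. -/
theorem SameHoldings.after_issue {p : ℕ} {G₁ : Type} {u v v' u' : User p G₁} {a : ZMod p} (h : SameHoldings u v)
    (hv : v' = v ∨ ∃ cred, v' = v.store a cred) (hnone : v'.creds a = none → u' = u)
    (hsome : v'.creds a ≠ none → ∃ cred, u' = u.store a cred) : SameHoldings u' v' := by
  by_cases hc : v'.creds a = none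
  · rw [hnone hc]
    rcases hv with rfl | ⟨cred, rfl⟩
    · exact h
    · simp [User.store] at hc
  · obtain ⟨cred, rfl⟩ := hsome hc
    intro a'
    by_cases ha : a' = a
    · subst ha
      simp [User.store, hc]
    · rcases hv with rfl | ⟨cred', rfl⟩ <;> simpa [User.store, ha] using h a'

section Simulation

variable {p : ℕ} [Fact p.Prime] {G₁ G₂ GT D W : Type}
  [AddCommGroup G₁] [Module (ZMod p) G₁] [AddCommGroup G₂] [Module (ZMod p) G₂]
  [AddCommGroup GT] [Module (ZMod p) GT]
  (P : Params p G₁ G₂ GT)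

/-! ### A coalition adversary used by the SP alone -/

/-- The simulator gets a sample of identification data before it starts its own run, so the sampling
must be moved to the front. On branches that stop earlier the extra sample is discarded. -/
theorem bind_runIssue_pure (pk : PublicKey G₁ G₂) (ts : TSRole p G₁ G₂ GT W)
    (sp : SPRole p G₁ G₂ D W) (ident : PMF D) (u : User p G₁) (a : ZMod p) (w : W) :
    (ident >>= fun d => runIssue P pk ts sp (pure d) u a w) =
      runIssue P pk ts sp ident u a w := by
  simp only [runIssue, pure_bind]
  rw [bind_swap]
  refine bind_congr fun μ => ?_
  rw [bind_swap]
  refine bind_congr fun w₁ => ?_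
  rw [bind_swap]
  refine bind_congr fun r => ?_
  rcases r with ⟨w₂, _ | V⟩
  · exact bind_const' _ _
  · exact bind_swap _ _ _

theorem bind_runShow_pure (pk : PublicKey G₁ G₂) (ts : TSRole p G₁ G₂ GT W)
    (sp : SPRole p G₁ G₂ D W) (ident : PMF D) (u : User p G₁) (a : ZMod p)
    (cred : Credential p G₁) (w : W) :
    (ident >>= fun d => runShow P pk ts sp (pure d) u a cred w) =
      runShow P pk ts sp ident u a cred w := by
  simp only [runShow, pure_bind]
  rw [bind_swap]
  refine bind_congr fun μ => ?_
  rw [bind_swap]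
  refine bind_congr fun w₁ => ?_
  rw [bind_swap]
  refine bind_congr fun r₁ => ?_
  rw [bind_swap]

theorem bind_runTCP_pure (pk : PublicKey G₁ G₂) (ts : TSRole p G₁ G₂ GT W)
    (sp : SPRole p G₁ G₂ D W) (ident : PMF D) (u : User p G₁) (aux : Aux p) (w : W) :
    (ident >>= fun d => runTCP P pk ts sp (pure d) u aux w) =
      runTCP P pk ts sp ident u aux w := by
  rcases aux with a | a
  · exact bind_runIssue_pure P pk ts sp ident u a w
  · rcases hc : u.creds a with _ | cred
    · simp only [runTCP, hc, bind_const']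
    · simp only [runTCP, hc, ← bind_assoc, bind_runShow_pure]

/-- The issuer key of the SP that runs a coalition adversary. -/
def simKey : PublicKey G₁ G₂ := ⟨P.h, P.g, P.g, P.g, P.g_ne, P.g_ne, P.g_ne⟩

variable (𝒜 : CoalitionAdversary p G₁ G₂ GT D)

/-- The state of the simulating SP after a run of the simulated user. -/
def afterRun {S : Type} (w : SimState p G₁ G₂ S) (r : S × User p G₁) : SimState p G₁ G₂ S :=
  ⟨r.1, w.pk, Function.update w.users w.cur r.2, !w.cur⟩

/-- The runs of the simulating SP, on its concrete state. -/
def simSP : SPRole p G₁ G₂ D (SimState p G₁ G₂ 𝒜.State) := (𝒜.asSP P).sp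

/-- The moves of the simulating SP outside of runs, on its concrete state. -/
def simDriver : Driver p (SimState p G₁ G₂ 𝒜.State) := (𝒜.asSP P).driver

/-! ### Coupling a real run with the simulated run inside the SP. -/

variable {β : Type}

/-- Real and simulated users are linked by a relation, not a function, so the comparison is stated
for continuations that agree on related results. -/
theorem runIssue_asSP_bind (ident : PMF D) (u : User p G₁) (a : ZMod p)
    (w : SimState p G₁ G₂ 𝒜.State) (t : ZMod p)
    {F : ((SimState p G₁ G₂ 𝒜.State) × ZMod p) × User p G₁ → PMF β}
    {F' : 𝒜.State × User p G₁ → PMF β}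
    (hF : ∀ r ∈ (runIssue P w.pk 𝒜.ts 𝒜.sp ident (w.users w.cur) a w.st).support, ∀ t' u',
      (r.2.creds a = none → u' = u) → (r.2.creds a ≠ none → ∃ cred, u' = u.store a cred) →
      F ((afterRun w r, t'), u') = F' r) :
    runIssue P (simKey P) (honestTS P (SimState p G₁ G₂ 𝒜.State)) ((simSP P 𝒜).lift (ZMod p)) ident u a
        (w, t) >>= F =
      runIssue P w.pk 𝒜.ts 𝒜.sp ident (w.users w.cur) a w.st >>= F' := by
  rw [← bind_runIssue_pure P w.pk] at hF ⊢
  conv_lhs => unfold runIssue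
  simp only [honestTS, pure_bind, bind_assoc, SPRole.lift, simSP, CoalitionAdversary.asSP, pmfMap_eq_bind,
    CoalitionAdversary.simRun, runTCP]
  -- The simulator ignores the real user's blinding and the honest TS's randomness, so these draws
  -- drop out one by one.
  refine (bind_congr fun μ => ?_).trans (bind_const' (unif p) _)
  refine (bind_congr fun s => ?_).trans (bind_const' (unif p) _)
  refine bind_congr_support _ fun d hd => bind_congr_support _ fun r hr => ?_
  refine (bind_congr fun tU => ?_).trans (bind_const' (unif p) _)
  refine (bind_congr fun k => ?_).trans (bind_const' (unif p) _)
  refine (bind_congr fun tS => ?_).trans (bind_const' (unif p) _)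
  specialize hF r (mem_support_monadBind.2 ⟨d, hd, hr⟩)
  rcases hc : r.2.creds a with _ | cred
  · simp only [Bool.not_not, Function.update_self, hc, Option.map_none, pure_bind]
    exact hF _ _ (fun _ => rfl) fun h => absurd hc h
  · simp only [Bool.not_not, Function.update_self, hc, Option.map_some]
    -- For secret key `1` and `e = 0` the signing exponent is `1`, and with the honest reply `V` the
    -- element `U` contains the full key: the real user accepts.
    rw [if_pos, pure_bind]
    · exact hF _ _ (fun h => absurd (hc.symm.trans h) (by simp)) fun _ => ⟨_, rfl⟩
    · simp only [ValidCred, simKey, zero_smul, zero_add, add_zero]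
      congr 2
      module

theorem runShow_asSP_bind (ident : PMF D) (u : User p G₁) (a : ZMod p) (cred : Credential p G₁)
    (w : SimState p G₁ G₂ 𝒜.State) (t : ZMod p)
    {F : (SimState p G₁ G₂ 𝒜.State) × ZMod p → PMF β}
    {F' : 𝒜.State × User p G₁ → PMF β}
    (hF : ∀ r ∈ (runTCP P w.pk 𝒜.ts 𝒜.sp ident (w.users w.cur) (.present a) w.st).support,
      ∀ t', F (afterRun w r, t') = F' r) :
    runShow P (simKey P) (honestTS P (SimState p G₁ G₂ 𝒜.State)) ((simSP P 𝒜).lift (ZMod p)) ident u a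
        cred (w, t) >>= F =
      runTCP P w.pk 𝒜.ts 𝒜.sp ident (w.users w.cur) (.present a) w.st >>= F' := by
  rw [← bind_runTCP_pure P w.pk] at hF ⊢
  simp only [runShow, honestTS, pure_bind, bind_assoc, SPRole.lift, simSP, CoalitionAdversary.asSP,
    pmfMap_eq_bind, CoalitionAdversary.simRun]
  refine (bind_congr fun μ => ?_).trans (bind_const' (unif p) _)
  refine (bind_congr fun r₁ => ?_).trans (bind_const' (unif p) _)
  refine (bind_congr fun r₂ => ?_).trans (bind_const' (unif p) _)
  exact bind_congr_support _ fun d hd => bind_congr_support _ fun r hr =>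
    hF r (mem_support_monadBind.2 ⟨d, hd, hr⟩) _

theorem runShow_support_user (pk : PublicKey G₁ G₂) (ts : TSRole p G₁ G₂ GT W)
    (sp : SPRole p G₁ G₂ D W) (ident : PMF D) (u : User p G₁) (a : ZMod p) (w : W) :
    ∀ r ∈ (runTCP P pk ts sp ident u (.present a) w).support, r.2 = u := by
  intro r hr
  simp only [runTCP] at hr
  rcases hc : u.creds a with _ | cred
  · simp only [hc] at hr
    rw [mem_support_monadPure.1 hr]
  · simp only [hc, mem_support_monadBind] at hr
    obtain ⟨w₁, -, hr⟩ := hr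
    rw [mem_support_monadPure.1 hr]

theorem runTCP_asSP_bind {ident : PMF D} {u : User p G₁} {aux : Aux p}
    {w : SimState p G₁ G₂ 𝒜.State} {t : ZMod p} (hu : SameHoldings u (w.users w.cur))
    {F : ((SimState p G₁ G₂ 𝒜.State) × ZMod p) × User p G₁ → PMF β}
    {F' : 𝒜.State × User p G₁ → PMF β}
    (hF : ∀ r ∈ (runTCP P w.pk 𝒜.ts 𝒜.sp ident (w.users w.cur) aux w.st).support, ∀ c t' u',
      SameHoldings u' r.2 →
      F ((⟨r.1, w.pk, Function.update w.users w.cur r.2, c⟩, t'), u') = F' r) :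
    runTCP P (simKey P) (honestTS P (SimState p G₁ G₂ 𝒜.State)) ((simSP P 𝒜).lift (ZMod p)) ident u aux
        (w, t) >>= F =
      runTCP P w.pk 𝒜.ts 𝒜.sp ident (w.users w.cur) aux w.st >>= F' := by
  rcases aux with a | a
  · refine runIssue_asSP_bind P 𝒜 ident u a w t fun r hr t' u' hnone hsome => ?_
    refine hF r hr _ t' u' (hu.after_issue ?_ hnone hsome)
    exact (runIssue_support P w.pk 𝒜.ts 𝒜.sp ident _ a _ r hr).imp_right
      fun ⟨cred, _, h⟩ => ⟨cred, h⟩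
  · rcases hc : u.creds a with _ | cred
    · have hc' := (hu a).1 hc
      -- No run takes place and `cur` is not flipped. This is why `hF` allows any value `c` there;
      -- the next query or challenge resets it.
      have := hF (w.st, w.users w.cur)
        (by simp only [runTCP, hc']; exact mem_support_monadPure.2 rfl) w.cur t u hu
      simp only [Function.update_eq_self] at this
      simp only [runTCP, hc, hc']
      rw [pure_bind, pure_bind]
      exact this
    · conv_lhs => simp only [runTCP, hc]
      rw [bind_assoc]
      refine runShow_asSP_bind P 𝒜 ident u a cred w t fun r hr t' => ?_
      rw [pure_bind]
      refine hF r hr _ t' u ?_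
      rwa [runShow_support_user P _ _ _ _ _ _ _ r hr]

/-- For the challenge, where the real user need not correspond to the simulated one: it suffices
that she really contacts the SP, as her final state is no longer used. -/
theorem runTCP_asSP_bind_of_canRun {ident : PMF D} {u : User p G₁} {aux : Aux p}
    {w : SimState p G₁ G₂ 𝒜.State} {t : ZMod p} (hu : u.CanRun aux)
    {F : ((SimState p G₁ G₂ 𝒜.State) × ZMod p) × User p G₁ → PMF β}
    {F' : 𝒜.State × User p G₁ → PMF β}
    (hF : ∀ r t' u', F ((afterRun w r, t'), u') = F' r) :
    runTCP P (simKey P) (honestTS P (SimState p G₁ G₂ 𝒜.State)) ((simSP P 𝒜).lift (ZMod p)) ident u aux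
        (w, t) >>= F =
      runTCP P w.pk 𝒜.ts 𝒜.sp ident (w.users w.cur) aux w.st >>= F' := by
  rcases aux with a | a
  · exact runIssue_asSP_bind P 𝒜 ident u a w t fun r _ t' u' _ _ => hF r t' u'
  · obtain ⟨cred, hc⟩ := Option.ne_none_iff_exists'.1 hu
    conv_lhs => simp only [runTCP, hc]
    rw [bind_assoc]
    refine runShow_asSP_bind P 𝒜 ident u a cred w t fun r _ t' => ?_
    rw [pure_bind]
    exact hF r t' u

/-! ### The whole game under simulation. -/

theorem queryPhase_asSP_bind (ident : Bool → Aux p → PMF D) (n : ℕ)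
    (w : SimState p G₁ G₂ 𝒜.State) (t : ZMod p) (us : Bool → User p G₁)
    (hus : ∀ i, SameHoldings (us i) (w.users i)) (hw : ∀ i, (w.users i).Sound P w.pk)
    {F : ((SimState p G₁ G₂ 𝒜.State) × ZMod p) × (Bool → User p G₁) → PMF β}
    {F' : 𝒜.State × (Bool → User p G₁) → PMF β}
    (hF : ∀ (w' : SimState p G₁ G₂ 𝒜.State) t' us', w'.pk = w.pk →
      (∀ i, SameHoldings (us' i) (w'.users i)) → (∀ i, (w'.users i).Sound P w.pk) →
      F ((w', t'), us') = F' (w'.st, w'.users)) :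
    queryPhase P (simKey P) (honestTS P (SimState p G₁ G₂ 𝒜.State)) ((simSP P 𝒜).lift (ZMod p))
        ((simDriver P 𝒜).lift (ZMod p)) ident n (w, t) us >>= F =
      queryPhase P w.pk 𝒜.ts 𝒜.sp 𝒜.driver ident n w.st w.users >>= F' := by
  induction n generalizing w t us with
  | zero =>
    simp only [queryPhase, pure_bind]
    exact hF w t us rfl hus hw
  | succ n ih =>
    have hnext : ∀ x : SimState p G₁ G₂ 𝒜.State × ZMod p,
        ((simDriver P 𝒜).lift (ZMod p)).next x = (𝒜.driver.next x.1.st >>= fun y =>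
          pure (({ x.1 with st := y.1, cur := (y.2.map Prod.fst).getD false }, x.2), y.2)) := by
      intro x
      simp only [Driver.lift, simDriver, CoalitionAdversary.asSP, pmfMap_eq_bind, bind_assoc, pure_bind]
    simp only [queryPhase]
    rw [hnext]
    simp only [bind_assoc]
    refine bind_congr fun ⟨st, query⟩ => ?_
    rcases query with _ | ⟨i, aux⟩
    · rw [pure_bind]
      dsimp only
      rw [pure_bind, pure_bind]
      exact hF _ _ _ rfl hus hw
    · rw [pure_bind]
      dsimp only [Option.map_some, Option.getD_some]
      rw [bind_assoc, bind_assoc]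
      refine runTCP_asSP_bind P 𝒜 (w := ⟨st, w.pk, w.users, i⟩) (hus i) fun r hr c t' u' hu' => ?_
      have hr' := runTCP_sound P _ _ _ _ (hw i) _ _ r hr
      refine ih ⟨r.1, w.pk, Function.update w.users i r.2, c⟩ t' _ (fun j => ?_) (fun j => ?_) hF
      · by_cases h : j = i
        · subst h
          simpa only [Function.update_self] using hu'
        · simpa only [Function.update_of_ne h] using hus j
      · exact forall_update (q := fun _ => User.Sound P w.pk) hw hr' j

theorem privacyGame_asSP (ident : Bool → Aux p → PMF D)
    (w : SimState p G₁ G₂ 𝒜.State) (t : ZMod p) (us : Bool → User p G₁)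
    (hus : ∀ i, SameHoldings (us i) (w.users i)) (hw : ∀ i, (w.users i).Sound P w.pk) :
    privacyGame P (simKey P) (honestTS P (SimState p G₁ G₂ 𝒜.State)) ((simSP P 𝒜).lift (ZMod p))
        ((simDriver P 𝒜).lift (ZMod p)) ident (w, t) us =
      privacyGame P w.pk 𝒜.ts 𝒜.sp 𝒜.driver ident w.st w.users := by
  have hchal : ∀ x : SimState p G₁ G₂ 𝒜.State × ZMod p,
      ((simDriver P 𝒜).lift (ZMod p)).challenge x = (𝒜.driver.challenge x.1.st >>= fun y =>
        pure (({ x.1 with st := y.1, cur := false }, x.2), y.2)) := by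
    intro x
    simp only [Driver.lift, simDriver, CoalitionAdversary.asSP, pmfMap_eq_bind, bind_assoc, pure_bind]
  unfold privacyGame
  refine queryPhase_asSP_bind P 𝒜 ident _ w t us hus hw fun w' t' us' hpk hus' hw' => ?_
  dsimp only
  rw [hchal, bind_assoc]
  refine bind_congr fun ⟨st, aux⟩ => ?_
  rw [pure_bind]
  dsimp only
  have hcan : ∀ i, (us' i).CanRun aux ↔ (w'.users i).CanRun aux := by
    intro i
    rcases aux with a | a
    · exact Iff.rfl
    · exact not_congr (hus' i a)
  by_cases hrun : (w'.users false).CanRun aux ∧ (w'.users true).CanRun aux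
  swap
  · rw [if_neg hrun, if_neg (mt (and_congr (hcan false) (hcan true)).1 hrun)]
  rw [if_pos hrun, if_pos ((and_congr (hcan false) (hcan true)).2 hrun)]
  have hall : ∀ i, (w'.users i).CanRun aux := by
    rintro (_ | _)
    exacts [hrun.1, hrun.2]
  refine bind_congr fun b => ?_
  have hfst := fun (i j : Bool) (d : PMF D) (s : 𝒜.State) =>
    map_fst_runTCP_eq P w.pk 𝒜.ts 𝒜.sp d (hw' i) (hw' j) (hall i) (hall j) s
  -- The simulated order is always `U₀`, `U₁`, while the identification data come from the real
  -- order `b`, `!b`.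
  let R₂ : 𝒜.State → PMF Bool := fun s =>
    (Prod.fst <$> runTCP P w.pk 𝒜.ts 𝒜.sp (ident (!b) aux) (w'.users true) aux s) >>= fun s' =>
      𝒜.driver.guess s' >>= fun g => pure (g == b)
  refine (runTCP_asSP_bind_of_canRun P 𝒜 (w := ⟨st, w'.pk, w'.users, false⟩) ((hcan b).2 (hall b))
    (F' := fun r => R₂ r.1) fun r t' u' => ?_).trans ?_
  · refine (runTCP_asSP_bind_of_canRun P 𝒜 ((hcan (!b)).2 (hall (!b)))
      (F' := fun r => 𝒜.driver.guess r.1 >>= fun g => pure (g == b)) fun r t' u' => rfl).trans ?_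
    simp only [R₂, bind_map_left, afterRun, hpk, Bool.not_false]
    rw [Function.update_of_ne (by simp)]
  · rw [← bind_map_left Prod.fst _ R₂]
    dsimp only
    -- Replaces the simulated `U₀` by `U_b`, keeping the identification data; the second run is
    -- treated likewise below.
    rw [hpk, hfst false b, bind_map_left]
    refine bind_congr fun r => ?_
    simp only [R₂]
    rw [hfst true (!b), bind_map_left]

theorem CoalitionAdversary.game_asSP (ident : Bool → Aux p → PMF D) :
    (𝒜.asSP P).game P ident = 𝒜.game P ident := by
  unfold SPAdversary.game CoalitionAdversary.game
  have hinit : (𝒜.asSP P).init = (𝒜.init >>= fun x => unif p >>= fun xU₀ => unif p >>= fun xU₁ =>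
      pure (⟨x.1, x.2.1, fun i => User.fresh (if i then xU₁ else xU₀) (x.2.2 i), false⟩,
        simKey P)) := rfl
  rw [hinit]
  simp only [bind_assoc]
  refine bind_congr fun x => bind_congr fun xU₀ => bind_congr fun xU₁ => ?_
  rw [pure_bind]
  -- The four key shares of the real users influence nothing in the simulation.
  refine (bind_congr fun _ => ?_).trans (bind_const' (unif p) _)
  refine (bind_congr fun _ => ?_).trans (bind_const' (unif p) _)
  refine (bind_congr fun _ => ?_).trans (bind_const' (unif p) _)
  refine (bind_congr fun _ => ?_).trans (bind_const' (unif p) _)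
  exact privacyGame_asSP P 𝒜 ident _ _ _ (fun i a => Iff.rfl) fun i => User.sound_fresh P _ _ _

theorem CoalitionAdversary.winProb_asSP (ident : Bool → Aux p → PMF D) :
    (𝒜.asSP P).winProb P ident = 𝒜.winProb P ident := by
  rw [SPAdversary.winProb, CoalitionAdversary.winProb, game_asSP]

end Simulation

end

end ThresholdBBS

open ThresholdBBS in
theorem mainTheorem4 {p : ℕ} [Fact p.Prime] {G₁ G₂ GT D : Type}
    [AddCommGroup G₁] [Module (ZMod p) G₁] [AddCommGroup G₂] [Module (ZMod p) G₂]
    [AddCommGroup GT] [Module (ZMod p) GT]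
    (P : Params p G₁ G₂ GT) (ident : Bool → Aux p → PMF D) :
    -- privacy against an honest SP, even if the SP can identify the users
    (∀ (ik : IssuerKey p G₁) (𝒜 : HonestSPAdversary p G₁ G₂ GT),
      𝒜.winProb P ident ik ≤ 1 / 2) ∧
    -- privacy against a colluding SP, if the SP alone cannot identify the users
    (∀ ε : ℝ,
      (∀ ℬ : SPAdversary p G₁ G₂ D, ℬ.winProb P ident ≤ 1 / 2 + ε) →
      ∀ 𝒜 : CoalitionAdversary p G₁ G₂ GT D, 𝒜.winProb P ident ≤ 1 / 2 + ε) ∧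
    -- the same adversary by adversary, with an explicit SP adversary
    (∀ 𝒜 : CoalitionAdversary p G₁ G₂ GT D,
      𝒜.winProb P ident ≤ (𝒜.asSP P).winProb P ident) := by
  refine ⟨fun ik 𝒜 => 𝒜.winProb_le_half P ident ik, fun ε h 𝒜 => ?_,
    fun 𝒜 => (𝒜.winProb_asSP P ident).ge⟩
  exact (𝒜.winProb_asSP P ident).ge.trans (h _)
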